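/- Let $d\ge 2$. For a positive integer $L$ let $\mathbb{Z}_L^d=\mathbb{Z}^d/L\mathbb{Z}^d$ be the discrete torus, let $\Delta_L$ be the nearest-neighbor Laplacian on $\ell^2(\mathbb{Z}_L^d)$, $(\Delta_L\psi)(x)=\sum_{i=1}^d\big(\psi(x+e_i)+\psi(x-e_i)\big)$, and let $H=\Delta_L+\lambda V$, where $V$ is multiplication by a random potential $(V(x))_{x\in\mathbb{Z}_L^d}$ with independent standard Gaussian entries. For a self-adjoint matrix $A$ and $f:\mathbb{R}\to\mathbb{C}$, let $f(A)$ be the operator with $f(A)\psi=f(E)\psi$ whenever $A\psi=E\psi$. For $\chi:\mathbb{R}\to\mathbb{C}$, $E\in\mathbb{R}$ and $\delta>0$ put $\chi_{\delta,E}(x)=\chi((x-E)/\delta)$. There is $\lambda_0\in(0,1)$, depending only on $d$, such that for every $\chi\in C_c^\infty(\mathbb{R};\mathbb{C})$ there is a constant $c>0$, depending only on $d$ and $\chi$, with the following property. Let $0<\lambda<\lambda_0$, let $L$ be equal to $\lambda^{-100}$ up to rounding (that is, $L$ is a positive integer with $|L-\lambda^{-100}|<1$), and let $K\ge 1$. Then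 with probability at least $1-\exp(-cK^2)$ the estimate $$\|\chi_{\delta,E}(H)-\chi_{\delta,E}(\Delta_L)\|_{\ell^2\to\ell^2}\le K(\log\lambda^{-1})^2\,\lambda\,\delta^{-1/2}$$ holds simultaneously for all $E\in\mathbb{R}$ and all $\delta>0$. -/

import Mathlib

open MeasureTheory ProbabilityTheory
open scoped ContDiff

namespace Anderson

/-- The discrete torus `ℤ_L^d = ℤ^d / L ℤ^d`. -/
abbrev Torus (d L : ℕ) : Type := Fin d → ZMod L

/-- The nearest-neighbor Laplacian `Δ_L` on the torus,
`(Δ_L ψ)(x) = ∑_i (ψ(x + e_i) + ψ(x - e_i))` (hopping convention, with spectrum in `[-2d, 2d]`),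
as a matrix. -/
def laplacian (d L : ℕ) : Matrix (Torus d L) (Torus d L) ℂ :=
  Matrix.of fun x y => ∑ i : Fin d,
    ((if y = x + Pi.single i 1 then 1 else 0) + (if y = x - Pi.single i 1 then 1 else 0))

/-- The Anderson Hamiltonian `H = Δ_L + lam • V`, where the potential `V` acts by multiplication. -/
def hamiltonian (d L : ℕ) (lam : ℝ) (V : Torus d L → ℝ) : Matrix (Torus d L) (Torus d L) ℂ :=
  laplacian d L + (lam : ℂ) • Matrix.diagonal fun x => (V x : ℂ)

theorem laplacian_mulVec (d L : ℕ) [NeZero L] (ψ : Torus d L → ℂ) (x : Torus d L) :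
    (laplacian d L).mulVec ψ x =
      ∑ i : Fin d, (ψ (x + Pi.single i 1) + ψ (x - Pi.single i 1)) := by
  simp only [Matrix.mulVec, dotProduct, laplacian, Matrix.of_apply, Finset.sum_mul]
  rw [Finset.sum_comm]
  simp [add_mul, Finset.sum_add_distrib]

theorem laplacian_isHermitian (d L : ℕ) : (laplacian d L).IsHermitian := by
  ext x y
  simp only [laplacian, Matrix.conjTranspose_apply, Matrix.of_apply, star_sum, star_add]
  refine Finset.sum_congr rfl fun i _ => ?_
  have h1 : (x = y + Pi.single i 1) ↔ (y = x - Pi.single i 1) :=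
    ⟨fun h => by rw [h]; simp, fun h => by rw [h]; simp⟩
  have h2 : (x = y - Pi.single i 1) ↔ (y = x + Pi.single i 1) :=
    ⟨fun h => by rw [h]; simp, fun h => by rw [h]; simp⟩
  simp only [h1, h2]
  rw [add_comm]
  congr 1 <;> split_ifs <;> simp

theorem hamiltonian_isHermitian (d L : ℕ) (lam : ℝ) (V : Torus d L → ℝ) :
    (hamiltonian d L lam V).IsHermitian := by
  refine (laplacian_isHermitian d L).add ?_
  rw [Matrix.IsHermitian, Matrix.conjTranspose_smul, Matrix.diagonal_conjTranspose]
  congr 1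
  · simp
  · congr 1
    ext x
    simp

section FunctionalCalculus

variable {n : Type*} [Fintype n] [DecidableEq n]

/-- The operator `f(A)` for a Hermitian matrix `A`: with `A = U diag(E_j) U*`, it is
`U diag(f(E_j)) U*`. See `applyFun_mulVec` for the characterization by eigenvectors. -/
noncomputable def applyFun {A : Matrix n n ℂ} (hA : A.IsHermitian) (f : ℝ → ℂ) : Matrix n n ℂ :=
  (hA.eigenvectorUnitary : Matrix n n ℂ) * Matrix.diagonal (fun j => f (hA.eigenvalues j)) *
    star (hA.eigenvectorUnitary : Matrix n n ℂ)

/-- `f(A) ψ = f(E) ψ` whenever `A ψ = E ψ`. -/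
theorem applyFun_mulVec {A : Matrix n n ℂ} (hA : A.IsHermitian) (f : ℝ → ℂ) (E : ℝ) (ψ : n → ℂ)
    (h : A.mulVec ψ = (E : ℂ) • ψ) : (applyFun hA f).mulVec ψ = f E • ψ := by
  set U : Matrix n n ℂ := (hA.eigenvectorUnitary : Matrix n n ℂ) with hU
  have hUU : star U * U = 1 := Unitary.coe_star_mul_self _
  have hUU' : U * star U = 1 := Unitary.coe_mul_star_self _
  have hs : A = U * Matrix.diagonal (fun j => ((hA.eigenvalues j : ℝ) : ℂ)) * star U := by
    have := hA.spectral_theorem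
    rw [Unitary.conjStarAlgAut_apply] at this
    exact this
  set φ := (star U).mulVec ψ with hφ
  have hψ : ψ = U.mulVec φ := by
    rw [hφ, Matrix.mulVec_mulVec, hUU', Matrix.one_mulVec]
  have h1 : (Matrix.diagonal (fun j => ((hA.eigenvalues j : ℝ) : ℂ))).mulVec φ = (E : ℂ) • φ := by
    have h2 : (star U).mulVec (A.mulVec ψ) = (E : ℂ) • φ := by
      rw [h, Matrix.mulVec_smul]
    rw [← h2, hφ, Matrix.mulVec_mulVec, Matrix.mulVec_mulVec]
    congr 1
    conv_rhs => rw [hs]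
    rw [← Matrix.mul_assoc, ← Matrix.mul_assoc, hUU, Matrix.one_mul]
  have h3 : (Matrix.diagonal (fun j => f (hA.eigenvalues j))).mulVec φ = f E • φ := by
    ext j
    have hj := congrFun h1 j
    simp only [Matrix.mulVec_diagonal, Pi.smul_apply, smul_eq_mul] at hj ⊢
    by_cases hz : φ j = 0
    · simp [hz]
    · have := mul_right_cancel₀ hz hj
      rw [Complex.ofReal_inj.mp this]
  have h4 : (applyFun hA f).mulVec ψ =
      U.mulVec ((Matrix.diagonal (fun j => f (hA.eigenvalues j))).mulVec φ) := by
    rw [hφ, Matrix.mulVec_mulVec, Matrix.mulVec_mulVec, applyFun]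
  rw [h4, h3, Matrix.mulVec_smul, ← hψ]

/-- The `ℓ² → ℓ²` operator norm of a matrix. -/
noncomputable def opNorm (A : Matrix n n ℂ) : ℝ := ‖Matrix.toEuclideanCLM (n := n) (𝕜 := ℂ) A‖

end FunctionalCalculus

/-- The law of the random potential: independent standard Gaussian entries on the torus. -/
noncomputable def potentialLaw (d L : ℕ) [NeZero L] : Measure (Torus d L → ℝ) :=
  Measure.pi fun _ => gaussianReal 0 1

/-- `χ_{δ,E}(x) = χ((x - E)/δ)`. -/
noncomputable def rescale (χ : ℝ → ℂ) (δ E : ℝ) : ℝ → ℂ := fun x => χ ((x - E) / δ)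

end Anderson

/-!
Smooth functions of `H = Δ + λ V` are compared with those of `Δ` through Lorentzians
`q_{u,s}(x) = s² / ((x - u)² + s²)`, which are `s` times the imaginary part of a resolvent.

*From Lorentzians to test functions.* The kernel `κ(|v|) = ∫₀¹ s² / (v² + s²) ds` has second
derivative `2 / (1 + v²)² - π δ₀`, so every `χ ∈ C_c²` is an explicit superposition of `q_{u,s}`,
`0 < s ≤ 1`, with density `χ''`, and of `q_{u,1}²` with density `χ` (`eq_integral_lorentz`).
Consequently, if `‖q_{u,s}(H) - q_{u,s}(Δ)‖ ≤ τ s^{-1/2}` for all `u` and `s`, then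
`‖χ_{δ,E}(H) - χ_{δ,E}(Δ)‖ ≤ C_χ τ δ^{-1/2}` for all `E` and `δ`
(`norm_rescale_sub_le_of_lorentz`).

*From Lorentzians to a Gaussian matrix.* With `w(x) = 1 / (|x - u| + s)`, comparable to the modulus
of the resolvent, the resolvent identity gives
`‖q_{u,s}(H) - q_{u,s}(Δ)‖ ≤ 8 λ ‖w(Δ)^{1/2} V w(Δ)^{1/2}‖` (`norm_sub_applyFun_lorentz_le`).

*The norm of the Gaussian matrix.* The matrix `w(Δ)^{1/2} V w(Δ)^{1/2}` is linear in the independent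
Gaussians `V(x)`. Its trace moments are controlled by integrating by parts, as in the proof of the
noncommutative Khintchine inequality (`integral_trace_pow_succ_le`), which gives Gaussian tails on
the scale `√(p ρ / s)` (`measureReal_norm_matrixSeries_ge_le`). Here `ρ = w(Δ)_{xx}` is, by
the Fourier transform, the average of `w` over the dispersion relation `∑ 2 cos (2 π k_i / L)`;
in dimension `d ≥ 2` it is `O(log² (1/s))` (`avg_weight_dispersion_le`): one logarithm comes
from the decay of `w`, one from the van Hove singularity.

*Union bound.* Weights at nearby `(u, s)` are comparable, so only polynomially many points
in `1/λ` are needed (`norm_sandwich_le_of_grid`), and widths `s < λ²` are trivial. Taking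
`p ≈ K² log (1/λ)` yields the Lorentzian bound with `τ = C K λ log^{3/2} (1/λ)`
(`measureReal_lorentz_bound_ge`). The remaining factor `√log (1/λ)` absorbs the constant `C_χ`
when `K √log (1/λ)` is large; otherwise `λ` is bounded below in terms of `χ`, and it suffices that
all entries of `V` are small, an event whose probability is then bounded below.
-/


namespace Anderson

/-! ### Functional calculus of Hermitian matrices -/

section Calculus

open scoped Matrix.Norms.L2Operator

variable {n : Type*} [Fintype n] [DecidableEq n]

/-- Every unitary diagonalization computes the functional calculus, not only the one chosen in the
definition of `applyFun`. -/
theorem applyFun_eq_of_diagonalization {A : Matrix n n ℂ} (hA : A.IsHermitian) {U : Matrix n n ℂ}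
    (hU : U * star U = 1) (e : n → ℝ)
    (h : A = U * Matrix.diagonal (fun j => (e j : ℂ)) * star U) (f : ℝ → ℂ) :
    applyFun hA f = U * Matrix.diagonal (fun j => f (e j)) * star U := by
  have hU' : star U * U = 1 := mul_eq_one_comm.mp hU
  have hAU : A * U = U * Matrix.diagonal (fun j => (e j : ℂ)) := by
    rw [h, Matrix.mul_assoc, hU', Matrix.mul_one]
  have key : applyFun hA f * U = U * Matrix.diagonal (fun j => f (e j)) := by
    ext i j
    have hcol : A.mulVec (fun i => U i j) = (e j : ℂ) • fun i => U i j := by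
      ext i
      have := congrFun (congrFun hAU i) j
      rw [Matrix.mul_diagonal] at this
      simpa [Matrix.mul_apply, Matrix.mulVec, dotProduct, mul_comm] using this
    have := congrFun (applyFun_mulVec hA f (e j) _ hcol) i
    rw [Matrix.mul_diagonal]
    simpa [Matrix.mul_apply, Matrix.mulVec, dotProduct, mul_comm] using this
  rw [← key, Matrix.mul_assoc, hU, Matrix.mul_one]

variable {A : Matrix n n ℂ} (hA : A.IsHermitian)

theorem eigenvectorUnitary_mul_star :
    (hA.eigenvectorUnitary : Matrix n n ℂ) * star (hA.eigenvectorUnitary : Matrix n n ℂ) = 1 :=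
  Unitary.coe_mul_star_self _

theorem star_eigenvectorUnitary_mul :
    star (hA.eigenvectorUnitary : Matrix n n ℂ) * (hA.eigenvectorUnitary : Matrix n n ℂ) = 1 :=
  Unitary.coe_star_mul_self _

theorem applyFun_ofReal : applyFun hA (fun x => (x : ℂ)) = A := by
  have := hA.spectral_theorem
  rw [Unitary.conjStarAlgAut_apply] at this
  exact this.symm

theorem applyFun_mul (f g : ℝ → ℂ) :
    applyFun hA f * applyFun hA g = applyFun hA (fun x => f x * g x) := by
  simp only [applyFun]
  set U : Matrix n n ℂ := (hA.eigenvectorUnitary : Matrix n n ℂ)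
  have h : star U * U = 1 := star_eigenvectorUnitary_mul hA
  calc U * Matrix.diagonal (fun j => f (hA.eigenvalues j)) * star U *
        (U * Matrix.diagonal (fun j => g (hA.eigenvalues j)) * star U)
      = U * Matrix.diagonal (fun j => f (hA.eigenvalues j)) * (star U * U) *
        Matrix.diagonal (fun j => g (hA.eigenvalues j)) * star U := by
          simp only [Matrix.mul_assoc]
    _ = _ := by rw [h, Matrix.mul_one, Matrix.mul_assoc U, Matrix.diagonal_mul_diagonal]

theorem applyFun_sub (f g : ℝ → ℂ) :
    applyFun hA f - applyFun hA g = applyFun hA (fun x => f x - g x) := by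
  simp only [applyFun]
  rw [← Matrix.sub_mul, ← Matrix.mul_sub, Matrix.diagonal_sub]

theorem applyFun_smul (c : ℂ) (f : ℝ → ℂ) :
    c • applyFun hA f = applyFun hA (fun x => c * f x) := by
  simp only [applyFun]
  rw [← Matrix.smul_mul, ← Matrix.mul_smul, ← Matrix.diagonal_smul]
  rfl

theorem applyFun_one : applyFun hA (fun _ => 1) = 1 := by
  simp only [applyFun, Matrix.diagonal_one, Matrix.mul_one]
  exact eigenvectorUnitary_mul_star hA

theorem star_applyFun (f : ℝ → ℂ) :
    star (applyFun hA f) = applyFun hA (fun x => star (f x)) := by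
  simp only [applyFun, Matrix.star_eq_conjTranspose, Matrix.conjTranspose_mul,
    Matrix.conjTranspose_conjTranspose, Matrix.diagonal_conjTranspose, Matrix.mul_assoc]
  rfl

theorem norm_conj_unitary {U : Matrix n n ℂ} (hU : U * star U = 1) (D : Matrix n n ℂ) :
    ‖U * D * star U‖ = ‖D‖ := by
  have hU' : star U * U = 1 := mul_eq_one_comm.mp hU
  have hmem : U ∈ unitary (Matrix n n ℂ) := ⟨hU', hU⟩
  rw [CStarRing.norm_mul_mem_unitary _ (Unitary.star_mem hmem),
    CStarRing.norm_mem_unitary_mul _ hmem]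

theorem norm_applyFun_le (f : ℝ → ℂ) {C : ℝ} (hC : 0 ≤ C)
    (h : ∀ j, ‖f (hA.eigenvalues j)‖ ≤ C) : ‖applyFun hA f‖ ≤ C := by
  rw [applyFun, norm_conj_unitary (eigenvectorUnitary_mul_star hA), Matrix.l2_opNorm_diagonal]
  exact (pi_norm_le_iff_of_nonneg hC).2 h

/-- The weight `w_{u,s}(x) = 1 / (|x - u| + s)`, comparable to the absolute value of the resolvent
function `x ↦ 1 / (x - (u + i s))`. -/
noncomputable def weight (u s x : ℝ) : ℝ := (|x - u| + s)⁻¹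

/-- The Lorentzian `q_{u,s}(x) = s² / ((x - u)² + s²)`, normalized to have maximum `1`. -/
noncomputable def lorentz (u s x : ℝ) : ℝ := s ^ 2 / ((x - u) ^ 2 + s ^ 2)

/-- The operator `w_{u,s}(A)^{1/2}`. -/
noncomputable def sqrtWeight (u s : ℝ) : Matrix n n ℂ :=
  applyFun hA fun x => ((Real.sqrt (weight u s x) : ℝ) : ℂ)

theorem weight_pos {u s : ℝ} (hs : 0 < s) (x : ℝ) : 0 < weight u s x := by
  unfold weight; positivity

theorem lorentz_nonneg (u s x : ℝ) : 0 ≤ lorentz u s x := by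
  unfold lorentz; positivity

theorem lorentz_le_one (u s x : ℝ) : lorentz u s x ≤ 1 := by
  unfold lorentz
  exact div_le_one_of_le₀ (by nlinarith [sq_nonneg (x - u)]) (by positivity)

theorem norm_applyFun_lorentz_le (u s : ℝ) : ‖applyFun hA fun x => (lorentz u s x : ℂ)‖ ≤ 1 := by
  refine norm_applyFun_le hA _ zero_le_one fun j => ?_
  rw [Complex.norm_real, Real.norm_of_nonneg (lorentz_nonneg _ _ _)]
  exact lorentz_le_one _ _ _

theorem norm_sqrtWeight_le {u s : ℝ} (hs : 0 < s) : ‖sqrtWeight hA u s‖ ≤ Real.sqrt s⁻¹ := by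
  refine norm_applyFun_le hA _ (Real.sqrt_nonneg _) fun j => ?_
  rw [Complex.norm_real, Real.norm_of_nonneg (Real.sqrt_nonneg _)]
  refine Real.sqrt_le_sqrt ?_
  unfold weight
  gcongr
  linarith [abs_nonneg (hA.eigenvalues j - u)]

theorem star_sqrtWeight (u s : ℝ) : star (sqrtWeight hA u s) = sqrtWeight hA u s := by
  rw [sqrtWeight, star_applyFun]
  simp

theorem sqrtWeight_mul_self {u s : ℝ} (hs : 0 < s) :
    sqrtWeight hA u s * sqrtWeight hA u s = applyFun hA fun x => (weight u s x : ℂ) := by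
  rw [sqrtWeight, applyFun_mul]
  congr 1
  ext x
  rw [← Complex.ofReal_mul, Real.mul_self_sqrt (weight_pos hs x).le]

/-- If one weight dominates another on the spectrum, the sandwiched operator only changes by the
same factor: `√w = d √w'` with `|d|² ≤ κ`. -/
theorem norm_sandwich_le_of_weight_le (W : Matrix n n ℂ) {u s u' s' κ : ℝ} (hs' : 0 < s')
    (h : ∀ j, weight u s (hA.eigenvalues j) ≤ κ * weight u' s' (hA.eigenvalues j)) (hs : 0 < s)
    (hκ : 0 ≤ κ) :
    ‖sqrtWeight hA u s * W * sqrtWeight hA u s‖ ≤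
      κ * ‖sqrtWeight hA u' s' * W * sqrtWeight hA u' s'‖ := by
  set D := applyFun hA fun x => ((Real.sqrt (weight u s x) / Real.sqrt (weight u' s' x) : ℝ) : ℂ)
  have hw : ∀ x, ((Real.sqrt (weight u' s' x) : ℝ) : ℂ) ≠ 0 := fun x => by
    exact_mod_cast (Real.sqrt_pos.2 (weight_pos hs' x)).ne'
  have h1 : sqrtWeight hA u s = D * sqrtWeight hA u' s' := by
    rw [sqrtWeight, sqrtWeight, applyFun_mul]
    congr 1; ext x
    push_cast
    rw [div_mul_cancel₀ _ (hw x)]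
  have h2 : sqrtWeight hA u s = sqrtWeight hA u' s' * D := by
    rw [sqrtWeight, sqrtWeight, applyFun_mul]
    congr 1; ext x
    push_cast
    rw [mul_div_cancel₀ _ (hw x)]
  have hD : ‖D‖ ≤ Real.sqrt κ := by
    refine norm_applyFun_le hA _ (Real.sqrt_nonneg _) fun j => ?_
    rw [Complex.norm_real, Real.norm_of_nonneg (by positivity), ← Real.sqrt_div
      (weight_pos hs _).le]
    exact Real.sqrt_le_sqrt ((div_le_iff₀ (weight_pos hs' _)).2 (h j))
  calc ‖sqrtWeight hA u s * W * sqrtWeight hA u s‖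
      = ‖D * (sqrtWeight hA u' s' * W * sqrtWeight hA u' s') * D‖ := by
        nth_rewrite 1 [h1]
        rw [h2]
        simp only [Matrix.mul_assoc]
    _ ≤ ‖D‖ * ‖sqrtWeight hA u' s' * W * sqrtWeight hA u' s'‖ * ‖D‖ :=
        (norm_mul_le _ _).trans (mul_le_mul_of_nonneg_right (norm_mul_le _ _) (norm_nonneg _))
    _ ≤ Real.sqrt κ * ‖sqrtWeight hA u' s' * W * sqrtWeight hA u' s'‖ * Real.sqrt κ := by gcongr
    _ = κ * ‖sqrtWeight hA u' s' * W * sqrtWeight hA u' s'‖ := by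
        rw [mul_right_comm, Real.mul_self_sqrt hκ]

/-- The resolvent function `x ↦ 1 / (x - (u + i s))`. -/
noncomputable def resolventFun (u s x : ℝ) : ℂ := ((x : ℂ) - (u + s * Complex.I))⁻¹

theorem sub_ne_zero_of_pos {u s : ℝ} (hs : 0 < s) (x : ℝ) :
    (x : ℂ) - (u + s * Complex.I) ≠ 0 := by
  intro h
  have := congrArg Complex.im h
  simp at this
  exact hs.ne' this

theorem applyFun_resolventFun_mul {u s : ℝ} (hs : 0 < s) :
    applyFun hA (resolventFun u s) * (A - ((u : ℂ) + s * Complex.I) • (1 : Matrix n n ℂ)) = 1 := by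
  have h : A - ((u : ℂ) + s * Complex.I) • (1 : Matrix n n ℂ) =
      applyFun hA fun x => (x : ℂ) - ((u : ℂ) + s * Complex.I) * 1 := by
    rw [← applyFun_sub, ← applyFun_smul, applyFun_one, applyFun_ofReal]
  rw [h, applyFun_mul, ← applyFun_one hA]
  congr 1; ext x
  rw [resolventFun, mul_one, inv_mul_cancel₀ (sub_ne_zero_of_pos hs x)]

theorem applyFun_lorentz {u s : ℝ} (hs : 0 < s) :
    applyFun hA (fun x => (lorentz u s x : ℂ)) =
      ((s : ℂ) / (2 * Complex.I)) •
        (applyFun hA (resolventFun u s) - star (applyFun hA (resolventFun u s))) := by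
  rw [star_applyFun, applyFun_sub, applyFun_smul]
  congr 1; ext x
  have h1 := sub_ne_zero_of_pos (u := u) hs x
  have h2 : (x : ℂ) - (u - s * Complex.I) ≠ 0 := by
    intro h
    have := congrArg Complex.im h
    simp at this
    exact hs.ne' this
  have h3 : ((x : ℂ) - u) ^ 2 + s ^ 2 ≠ 0 := by
    have : ((x - u) ^ 2 + s ^ 2 : ℝ) ≠ 0 := by positivity
    exact_mod_cast this
  simp only [resolventFun, lorentz, Complex.star_def, map_inv₀, map_sub, map_add, map_mul,
    Complex.conj_ofReal, Complex.conj_I]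
  rw [show ((u : ℂ) + s * -Complex.I) = u - s * Complex.I by ring, inv_sub_inv h1 h2,
    show ((x : ℂ) - (u + s * Complex.I)) * (x - (u - s * Complex.I)) = (x - u) ^ 2 + s ^ 2 by
      ring_nf; rw [Complex.I_sq]; ring]
  push_cast
  field_simp
  ring

theorem norm_sub_applyFun_lorentz_le_resolvent {B : Matrix n n ℂ} (hB : B.IsHermitian) {u s : ℝ}
    (hs : 0 < s) :
    ‖applyFun hB (fun x => (lorentz u s x : ℂ)) - applyFun hA (fun x => (lorentz u s x : ℂ))‖ ≤
      s * ‖applyFun hB (resolventFun u s) - applyFun hA (resolventFun u s)‖ := by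
  rw [applyFun_lorentz hA hs, applyFun_lorentz hB hs, ← smul_sub]
  set X := applyFun hB (resolventFun u s)
  set Y := applyFun hA (resolventFun u s)
  have : X - star X - (Y - star Y) = (X - Y) - star (X - Y) := by rw [star_sub]; abel
  rw [this, norm_smul]
  have h1 : ‖(s : ℂ) / (2 * Complex.I)‖ = s / 2 := by simp [abs_of_pos hs]
  have h2 : ‖(X - Y) - star (X - Y)‖ ≤ 2 * ‖X - Y‖ := by
    refine (norm_sub_le _ _).trans ?_
    rw [norm_star]; linarith
  rw [h1]
  calc s / 2 * ‖(X - Y) - star (X - Y)‖ ≤ s / 2 * (2 * ‖X - Y‖) := by gcongr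
    _ = s * ‖X - Y‖ := by ring

theorem norm_sub_le_of_sub_eq {R : Type*} [NormedRing R] {X S M : R} (h : X - S = -(X * M * S))
    (hS : ‖S‖ ≤ 2) (hM : ‖M‖ ≤ 1 / 4) : ‖X - S‖ ≤ 8 * ‖M‖ := by
  have h1 : ‖X - S‖ ≤ ‖X‖ * ‖M‖ * 2 := by
    rw [h, norm_neg]
    refine (norm_mul_le _ _).trans ?_
    exact mul_le_mul (norm_mul_le _ _) hS (norm_nonneg _) (by positivity)
  have h2 : ‖X‖ ≤ ‖X - S‖ + ‖S‖ := by simpa using norm_add_le (X - S) S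
  have h3 : ‖X‖ * ‖M‖ ≤ ‖X‖ * (1 / 4) := by gcongr
  have h4 : ‖X‖ * ‖M‖ ≤ 4 * ‖M‖ := by gcongr; linarith
  linarith

/-- The perturbation estimate. With `G = w_{u,s}(A)^{1/2}` one has
`R_B - R_A = G (X - S) G`, where `S = G⁻¹ R_A G⁻¹` has norm at most `2` and
`X = G⁻¹ R_B G⁻¹` solves `X = S - X (G W G) S`; a small sandwiched perturbation `G W G`
therefore controls the difference of the resolvents. -/
theorem norm_sub_applyFun_lorentz_le {B W : Matrix n n ℂ} (hB : B.IsHermitian) (hBA : B = A + W)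
    {u s : ℝ} (hs : 0 < s) :
    ‖applyFun hB (fun x => (lorentz u s x : ℂ)) - applyFun hA (fun x => (lorentz u s x : ℂ))‖ ≤
      8 * ‖sqrtWeight hA u s * W * sqrtWeight hA u s‖ := by
  set M := sqrtWeight hA u s * W * sqrtWeight hA u s with hM
  set m := ‖M‖ with hm
  have hm0 : 0 ≤ m := norm_nonneg _
  by_cases hsmall : 1 / 4 < m
  · refine (norm_sub_le _ _).trans ?_
    linarith [norm_applyFun_lorentz_le hA u s, norm_applyFun_lorentz_le hB u s]
  push Not at hsmall
  set RA := applyFun hA (resolventFun u s) with hRA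
  set RB := applyFun hB (resolventFun u s) with hRB
  set G := sqrtWeight hA u s with hG
  set Gi := applyFun hA (fun x => ((Real.sqrt (weight u s x) : ℝ) : ℂ)⁻¹) with hGi
  have hw : ∀ x, ((Real.sqrt (weight u s x) : ℝ) : ℂ) ≠ 0 := fun x => by
    exact_mod_cast (Real.sqrt_pos.2 (weight_pos hs x)).ne'
  have hres := norm_sub_applyFun_lorentz_le_resolvent hA hB (u := u) hs
  rw [← hRA, ← hRB] at hres
  have hGGi : G * Gi = 1 := by
    rw [hG, sqrtWeight, hGi, applyFun_mul, ← applyFun_one hA]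
    congr 1; ext x
    exact mul_inv_cancel₀ (hw x)
  have hGiG : Gi * G = 1 := mul_eq_one_comm.mp hGGi
  set S := Gi * RA * Gi with hS
  set X := Gi * RB * Gi with hX
  have hSn : ‖S‖ ≤ 2 := by
    rw [hS, hGi, hRA, applyFun_mul, applyFun_mul]
    refine norm_applyFun_le hA _ zero_le_two fun j => ?_
    set x := hA.eigenvalues j
    have e1 : ((Real.sqrt (weight u s x) : ℝ) : ℂ)⁻¹ * resolventFun u s x *
        ((Real.sqrt (weight u s x) : ℝ) : ℂ)⁻¹ = ((|x - u| + s : ℝ) : ℂ) * resolventFun u s x := by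
      rw [mul_right_comm, ← mul_inv, ← Complex.ofReal_mul,
        Real.mul_self_sqrt (weight_pos hs x).le, weight, Complex.ofReal_inv, inv_inv]
    rw [e1, norm_mul, Complex.norm_real, Real.norm_of_nonneg (by positivity), resolventFun,
      norm_inv, ← div_eq_mul_inv]
    have hz := norm_pos_iff.2 (sub_ne_zero_of_pos (u := u) hs x)
    rw [div_le_iff₀ hz]
    have h1 := Complex.abs_re_le_norm ((x : ℂ) - (u + s * Complex.I))
    have h2 := Complex.abs_im_le_norm ((x : ℂ) - (u + s * Complex.I))
    simp only [Complex.sub_re, Complex.ofReal_re, Complex.add_re, Complex.mul_re, Complex.I_re,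
      mul_zero, Complex.ofReal_im, Complex.I_im, mul_one, sub_self, add_zero] at h1
    simp only [Complex.sub_im, Complex.ofReal_im, Complex.add_im, Complex.mul_im, Complex.I_re,
      mul_zero, Complex.ofReal_re, Complex.I_im, mul_one, add_zero, zero_add, zero_sub,
      abs_neg, abs_of_pos hs] at h2
    linarith
  have hRBA : RB - RA = -(RB * W * RA) := by
    have h1 := applyFun_resolventFun_mul hB (u := u) hs
    have h2 := mul_eq_one_comm.mp (applyFun_resolventFun_mul hA (u := u) hs)
    have hWd : W = (B - ((u : ℂ) + s * Complex.I) • (1 : Matrix n n ℂ)) -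
        (A - ((u : ℂ) + s * Complex.I) • (1 : Matrix n n ℂ)) := by rw [hBA]; abel
    rw [hWd, Matrix.mul_sub, Matrix.sub_mul, h1, Matrix.one_mul, Matrix.mul_assoc RB, h2,
      Matrix.mul_one]
    abel
  have hXS : X - S = -(X * M * S) := by
    calc X - S = Gi * (RB - RA) * Gi := by rw [hX, hS, Matrix.mul_sub, Matrix.sub_mul]
      _ = -(Gi * RB * (Gi * G) * W * (G * Gi) * RA * Gi) := by
        rw [hRBA, hGGi, hGiG]
        simp only [Matrix.mul_one, Matrix.mul_neg, Matrix.neg_mul, Matrix.mul_assoc]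
      _ = -(X * M * S) := by simp only [hX, hM, hS, Matrix.mul_assoc]
  have hb2 : ‖X - S‖ ≤ 8 * m := norm_sub_le_of_sub_eq hXS hSn hsmall
  have hdiff : RB - RA = G * (X - S) * G := by
    calc RB - RA = (G * Gi) * (RB - RA) * (Gi * G) := by
          rw [hGGi, hGiG, Matrix.one_mul, Matrix.mul_one]
      _ = G * (X - S) * G := by
          rw [hX, hS]
          simp only [Matrix.mul_sub, Matrix.sub_mul, Matrix.mul_assoc]
  have hGn : ‖G‖ ≤ Real.sqrt s⁻¹ := norm_sqrtWeight_le hA hs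
  clear_value G X S RA RB
  have hfin : ‖RB - RA‖ ≤ s⁻¹ * (8 * m) := by
    rw [hdiff]
    calc ‖G * (X - S) * G‖ ≤ ‖G‖ * ‖X - S‖ * ‖G‖ :=
          (norm_mul_le _ _).trans (mul_le_mul_of_nonneg_right (norm_mul_le _ _) (norm_nonneg _))
      _ ≤ Real.sqrt s⁻¹ * (8 * m) * Real.sqrt s⁻¹ := by gcongr
      _ = s⁻¹ * (8 * m) := by
          rw [mul_right_comm, Real.mul_self_sqrt (inv_nonneg.2 hs.le)]
  calc _ ≤ s * ‖RB - RA‖ := hres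
    _ ≤ s * (s⁻¹ * (8 * m)) := by gcongr
    _ = 8 * m := by rw [← mul_assoc, mul_inv_cancel₀ hs.ne', one_mul]

end Calculus


/-! ### Representing smooth functions by Lorentzians -/

/-- The profile `κ(v) = 1 - v (π/2 - arctan v)`, which for `v ≥ 0` equals `∫₀¹ s² / (v² + s²) ds`. -/
noncomputable def lorentzProfile (v : ℝ) : ℝ := 1 - v * (Real.pi / 2 - Real.arctan v)

/-- The derivative of `lorentzProfile`. -/
noncomputable def lorentzProfileDeriv (v : ℝ) : ℝ :=
  -(Real.pi / 2 - Real.arctan v) + v / (1 + v ^ 2)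

theorem hasDerivAt_lorentzProfile (v : ℝ) :
    HasDerivAt lorentzProfile (lorentzProfileDeriv v) v := by
  have h := ((hasDerivAt_id v).mul ((Real.hasDerivAt_arctan v).const_sub (Real.pi / 2))).const_sub 1
  refine h.congr_deriv ?_
  simp only [lorentzProfileDeriv, id]
  ring

theorem hasDerivAt_lorentzProfileDeriv (v : ℝ) :
    HasDerivAt lorentzProfileDeriv (2 / (1 + v ^ 2) ^ 2) v := by
  have h1 : HasDerivAt (fun v : ℝ => 1 + v ^ 2) (2 * v) v := by
    simpa using (hasDerivAt_pow 2 v).const_add 1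
  have h0 : (1 + v ^ 2) ≠ 0 := by positivity
  have h := ((Real.hasDerivAt_arctan v).const_sub (Real.pi / 2)).neg.add
    ((hasDerivAt_id v).div h1 h0)
  refine h.congr_deriv ?_
  simp only [id]
  field_simp
  ring

theorem continuous_lorentzProfile : Continuous lorentzProfile :=
  continuous_iff_continuousAt.2 fun v => (hasDerivAt_lorentzProfile v).continuousAt

theorem continuous_lorentzProfileDeriv : Continuous lorentzProfileDeriv :=
  continuous_iff_continuousAt.2 fun v => (hasDerivAt_lorentzProfileDeriv v).continuousAt

theorem hasDerivAt_sub_mul_arctan_div {v s : ℝ} (hv : 0 < v) :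
    HasDerivAt (fun s => s - v * Real.arctan (s / v)) (s ^ 2 / (v ^ 2 + s ^ 2)) s := by
  have h := (hasDerivAt_id s).sub
    (((hasDerivAt_id s).div_const v).arctan.const_mul v)
  refine h.congr_deriv ?_
  simp only [id]
  field_simp
  ring

theorem continuous_lorentz_of_ne {u x : ℝ} (h : x ≠ u) : Continuous fun s => lorentz u s x := by
  unfold lorentz
  refine Continuous.div (by fun_prop) (by fun_prop) fun s => ?_
  have := sub_ne_zero.2 h
  positivity

theorem integrableOn_lorentz (u x : ℝ) :
    IntegrableOn (fun s => lorentz u s x) (Set.Ioc 0 1) := by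
  have hm : Measurable fun s => lorentz u s x := by unfold lorentz; fun_prop
  refine Measure.integrableOn_of_bounded (M := 1) (by simp) hm.aestronglyMeasurable ?_
  refine Filter.Eventually.of_forall fun s => ?_
  rw [Real.norm_of_nonneg (lorentz_nonneg _ _ _)]
  exact lorentz_le_one _ _ _

theorem integral_lorentz (u x : ℝ) :
    ∫ s in Set.Ioc (0 : ℝ) 1, lorentz u s x = lorentzProfile |x - u| := by
  by_cases hxu : x = u
  · subst hxu
    have : ∫ s in Set.Ioc (0 : ℝ) 1, lorentz x s x = ∫ s in Set.Ioc (0 : ℝ) 1, (1 : ℝ) := by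
      refine setIntegral_congr_fun measurableSet_Ioc fun s hs => ?_
      have : s ≠ 0 := hs.1.ne'
      simp [lorentz, this]
    rw [this]
    simp [lorentzProfile]
  · have hv : 0 < |x - u| := abs_pos.2 (sub_ne_zero.2 hxu)
    rw [← intervalIntegral.integral_of_le zero_le_one]
    have hsq : |x - u| ^ 2 = (x - u) ^ 2 := sq_abs _
    have hd : ∀ s ∈ Set.uIcc (0 : ℝ) 1,
        HasDerivAt (fun s => s - |x - u| * Real.arctan (s / |x - u|)) (lorentz u s x) s := by
      intro s _
      have := hasDerivAt_sub_mul_arctan_div (s := s) hv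
      rwa [hsq] at this
    rw [intervalIntegral.integral_eq_sub_of_hasDerivAt hd
      ((continuous_lorentz_of_ne hxu).intervalIntegrable _ _)]
    rw [one_div, Real.arctan_inv_of_pos hv]
    simp [lorentzProfile]

/-- Integrating by parts twice on a half-line, where `lorentzProfile` is smooth. -/
theorem integral_Ioi_mul_lorentzProfile {g g' g'' : ℝ → ℂ} (hg : ∀ v, HasDerivAt g (g' v) v)
    (hg' : ∀ v, HasDerivAt g' (g'' v) v) (hg'' : Continuous g'') (hs : HasCompactSupport g)
    (hs' : HasCompactSupport g') (hs'' : HasCompactSupport g'') :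
    ∫ v in Set.Ioi (0 : ℝ), g'' v * (lorentzProfile v : ℂ) =
      (∫ v in Set.Ioi (0 : ℝ), g v * ((2 / (1 + v ^ 2) ^ 2 : ℝ) : ℂ)) -
        g' 0 - (Real.pi / 2 : ℝ) * g 0 := by
  have hgc : Continuous g := continuous_iff_continuousAt.2 fun v => (hg v).continuousAt
  have hgc' : Continuous g' := continuous_iff_continuousAt.2 fun v => (hg' v).continuousAt
  have hκ := Complex.continuous_ofReal.comp continuous_lorentzProfile
  have hκ' := Complex.continuous_ofReal.comp continuous_lorentzProfileDeriv
  have hκ'' : Continuous fun v : ℝ => ((2 / (1 + v ^ 2) ^ 2 : ℝ) : ℂ) := by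
    refine Complex.continuous_ofReal.comp (Continuous.div (by fun_prop) (by fun_prop) fun v => ?_)
    positivity
  have hd : ∀ v ∈ Set.Ici (0 : ℝ), HasDerivAt
      (fun v => g' v * (lorentzProfile v : ℂ) - g v * (lorentzProfileDeriv v : ℂ))
      (g'' v * (lorentzProfile v : ℂ) - g v * ((2 / (1 + v ^ 2) ^ 2 : ℝ) : ℂ)) v := by
    intro v _
    have h := ((hg' v).mul (hasDerivAt_lorentzProfile v).ofReal_comp).sub
      ((hg v).mul (hasDerivAt_lorentzProfileDeriv v).ofReal_comp)
    refine h.congr_deriv ?_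
    ring
  have i1 : Integrable fun v => g'' v * (lorentzProfile v : ℂ) :=
    (hg''.mul hκ).integrable_of_hasCompactSupport hs''.mul_right
  have i2 : Integrable fun v => g v * ((2 / (1 + v ^ 2) ^ 2 : ℝ) : ℂ) :=
    (hgc.mul hκ'').integrable_of_hasCompactSupport hs.mul_right
  have hsF : HasCompactSupport
      (fun v => g' v * (lorentzProfile v : ℂ) - g v * (lorentzProfileDeriv v : ℂ)) := by
    have h1 : HasCompactSupport fun v => g' v * (lorentzProfile v : ℂ) := hs'.mul_right
    have h2 : HasCompactSupport fun v => g v * (lorentzProfileDeriv v : ℂ) := hs.mul_right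
    exact h1.sub h2
  have hlim : Filter.Tendsto
      (fun v => g' v * (lorentzProfile v : ℂ) - g v * (lorentzProfileDeriv v : ℂ))
      Filter.atTop (nhds 0) :=
    hsF.is_zero_at_infty.mono_left atTop_le_cocompact
  have h := integral_Ioi_of_hasDerivAt_of_tendsto' hd
    (i1.integrableOn.sub i2.integrableOn) hlim
  rw [integral_sub i1.integrableOn i2.integrableOn] at h
  have h0 : lorentzProfile 0 = 1 := by simp [lorentzProfile]
  have h0' : lorentzProfileDeriv 0 = -(Real.pi / 2) := by simp [lorentzProfileDeriv]
  rw [h0, h0'] at h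
  rw [sub_eq_iff_eq_add] at h
  rw [h]
  push_cast
  ring

/-- A compactly supported `C²` function is a superposition of (squared) Lorentzians. The kernel
`v ↦ κ(|v|)` has second derivative `2 / (1 + v²)² - π δ₀`, since `κ'` jumps by `π` at the origin. -/
theorem eq_integral_lorentz {χ : ℝ → ℂ} (hχ : ContDiff ℝ 2 χ) (hs : HasCompactSupport χ) (x : ℝ) :
    χ x = (∫ u, ((2 / Real.pi : ℝ) : ℂ) * χ u * ((lorentz u 1 x : ℝ) : ℂ) ^ 2) -
      ∫ u, ((1 / Real.pi : ℝ) : ℂ) * deriv (deriv χ) u * (lorentzProfile |x - u| : ℂ) := by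
  have hd1 : ∀ v, HasDerivAt χ (deriv χ v) v := fun v =>
    (hχ.differentiable two_ne_zero v).hasDerivAt
  have hχ1 : ContDiff ℝ 1 (deriv χ) := by
    have : ContDiff ℝ (1 + 1) χ := by simpa [one_add_one_eq_two] using hχ
    exact (contDiff_succ_iff_deriv.1 this).2.2
  have hd2 : ∀ v, HasDerivAt (deriv χ) (deriv (deriv χ) v) v := fun v =>
    (hχ1.differentiable one_ne_zero v).hasDerivAt
  have hc : Continuous (deriv (deriv χ)) := hχ1.continuous_deriv le_rfl
  have hs1 := hs.deriv
  have hs2 := hs1.deriv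
  have cs : ∀ {f : ℝ → ℂ}, HasCompactSupport f → HasCompactSupport fun v => f (x + v) :=
    fun {f} hf => hf.comp_homeomorph (Homeomorph.addLeft x)
  have cs' : ∀ {f : ℝ → ℂ}, HasCompactSupport f → HasCompactSupport fun v => f (x - v) :=
    fun {f} hf => hf.comp_homeomorph (Homeomorph.subLeft x)
  have hp := integral_Ioi_mul_lorentzProfile (g := fun v => χ (x + v))
    (g' := fun v => deriv χ (x + v)) (g'' := fun v => deriv (deriv χ) (x + v))
    (fun v => (hd1 _).comp_const_add x v) (fun v => (hd2 _).comp_const_add x v)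
    (hc.comp (by fun_prop)) (cs hs) (cs hs1) (cs hs2)
  have hm := integral_Ioi_mul_lorentzProfile (g := fun v => χ (x - v))
    (g' := fun v => -deriv χ (x - v)) (g'' := fun v => deriv (deriv χ) (x - v))
    (fun v => by simpa using (hd1 (x - v)).comp_const_sub x v)
    (fun v => by simpa using ((hd2 (x - v)).comp_const_sub x v).fun_neg)
    (hc.comp (by fun_prop)) (cs' hs) (cs' hs1).neg (cs' hs2)
  have hκ : Continuous fun v : ℝ => ((lorentzProfile |v| : ℝ) : ℂ) :=
    Complex.continuous_ofReal.comp (continuous_lorentzProfile.comp continuous_abs)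
  have hq : Continuous fun v : ℝ => ((2 / (1 + v ^ 2) ^ 2 : ℝ) : ℂ) := by
    refine Complex.continuous_ofReal.comp (Continuous.div (by fun_prop) (by fun_prop) fun v => ?_)
    positivity
  -- splitting an integral at the point `x` and folding it onto the half-line
  have split : ∀ (f : ℝ → ℂ) (k : ℝ → ℂ), Continuous f → HasCompactSupport f → Continuous k →
      (∀ v, k (-v) = k v) → ∫ u, f u * k (x - u) =
        (∫ v in Set.Ioi (0 : ℝ), f (x + v) * k v) + ∫ v in Set.Ioi (0 : ℝ), f (x - v) * k v := by
    intro f k hf hfs hk hev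
    have hint : Integrable fun v => f (x + v) * k v :=
      ((hf.comp (by fun_prop)).mul hk).integrable_of_hasCompactSupport (cs hfs).mul_right
    have e1 : ∫ u, f u * k (x - u) = ∫ v, f (x + v) * k v := by
      rw [← integral_add_left_eq_self _ x]
      refine integral_congr_ae (Filter.Eventually.of_forall fun v => ?_)
      simp [hev]
    have e2 : ∫ v in Set.Ioi (0 : ℝ), f (x - v) * k v = ∫ v in Set.Iic (0 : ℝ), f (x + v) * k v := by
      have := integral_comp_neg_Ioi (0 : ℝ) (fun v => f (x + v) * k v)
      rw [neg_zero] at this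
      rw [← this]
      simp [hev, sub_eq_add_neg]
    rw [e1, e2, add_comm, intervalIntegral.integral_Iic_add_Ioi hint.integrableOn hint.integrableOn]
  have s1 := split _ _ hc hs2 hκ (fun v => by simp)
  have s2 := split _ _ hχ.continuous hs hq (fun v => by simp)
  have a1 : ∀ f : ℝ → ℂ, ∫ v in Set.Ioi (0 : ℝ), f v * ((lorentzProfile |v| : ℝ) : ℂ) =
      ∫ v in Set.Ioi (0 : ℝ), f v * ((lorentzProfile v : ℝ) : ℂ) := fun f =>
    setIntegral_congr_fun measurableSet_Ioi fun v hv => by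
      simp only [abs_of_pos (Set.mem_Ioi.1 hv)]
  rw [a1, a1, hp, hm] at s1
  have key : ∫ u, deriv (deriv χ) u * ((lorentzProfile |x - u| : ℝ) : ℂ) =
      (∫ u, χ u * ((2 / (1 + (x - u) ^ 2) ^ 2 : ℝ) : ℂ)) - Real.pi * χ x := by
    rw [s1, s2]
    simp only [add_zero, sub_zero]
    push_cast
    ring
  have f1 : ∫ u, ((2 / Real.pi : ℝ) : ℂ) * χ u * ((lorentz u 1 x : ℝ) : ℂ) ^ 2 =
      ((1 / Real.pi : ℝ) : ℂ) * ∫ u, χ u * ((2 / (1 + (x - u) ^ 2) ^ 2 : ℝ) : ℂ) := by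
    rw [← integral_const_mul]
    refine integral_congr_ae (Filter.Eventually.of_forall fun u => ?_)
    have e : (lorentz u 1 x) ^ 2 = ((1 + (x - u) ^ 2) ^ 2)⁻¹ := by
      rw [lorentz, one_pow, one_div, inv_pow, add_comm]
    simp only [← Complex.ofReal_pow]
    rw [e]
    generalize (1 + (x - u) ^ 2) ^ 2 = y
    push_cast
    ring
  have f2 : ∫ u, ((1 / Real.pi : ℝ) : ℂ) * deriv (deriv χ) u * (lorentzProfile |x - u| : ℂ) =
      ((1 / Real.pi : ℝ) : ℂ) * ∫ u, deriv (deriv χ) u * ((lorentzProfile |x - u| : ℝ) : ℂ) := by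
    rw [← integral_const_mul]
    simp only [mul_assoc]
  rw [f1, f2, key, mul_sub, sub_sub_cancel, ← mul_assoc]
  have : ((1 / Real.pi : ℝ) : ℂ) * (Real.pi : ℂ) = 1 := by
    rw [← Complex.ofReal_mul, one_div_mul_cancel Real.pi_ne_zero, Complex.ofReal_one]
  rw [this, one_mul]

section Transfer

open scoped Matrix.Norms.L2Operator

variable {n : Type*} [Fintype n] [DecidableEq n] {A B : Matrix n n ℂ}

theorem applyFun_eq_sum (hA : A.IsHermitian) (f : ℝ → ℂ) :
    applyFun hA f = ∑ j, f (hA.eigenvalues j) • ((hA.eigenvectorUnitary : Matrix n n ℂ) *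
      Matrix.single j j 1 * star (hA.eigenvectorUnitary : Matrix n n ℂ)) := by
  rw [applyFun, ← Matrix.sum_single_eq_diagonal]
  simp only [Matrix.mul_sum, Matrix.sum_mul]
  refine Finset.sum_congr rfl fun j _ => ?_
  rw [← Matrix.smul_mul, ← Matrix.mul_smul, Matrix.smul_single, smul_eq_mul, mul_one]

theorem applyFun_integral {α : Type*} [MeasurableSpace α] {μ : Measure α} (hA : A.IsHermitian)
    {k : α → ℝ → ℂ} (hk : ∀ x, Integrable (fun a => k a x) μ) :
    Integrable (fun a => applyFun hA (k a)) μ ∧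
      applyFun hA (fun x => ∫ a, k a x ∂μ) = ∫ a, applyFun hA (k a) ∂μ := by
  have h : ∀ j ∈ (Finset.univ : Finset n), Integrable (fun a => k a (hA.eigenvalues j) •
      ((hA.eigenvectorUnitary : Matrix n n ℂ) *
      Matrix.single j j 1 * star (hA.eigenvectorUnitary : Matrix n n ℂ))) μ :=
    fun j _ => (hk _).smul_const _
  simp only [applyFun_eq_sum hA]
  refine ⟨integrable_finsetSum _ h, ?_⟩
  rw [integral_finsetSum _ h]
  exact Finset.sum_congr rfl fun j _ => (integral_smul_const _ _).symm

theorem norm_applyFun_integral_sub_le {α : Type*} [MeasurableSpace α] {μ : Measure α}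
    (hA : A.IsHermitian) (hB : B.IsHermitian) {k : α → ℝ → ℂ}
    (hk : ∀ x, Integrable (fun a => k a x) μ) {b : α → ℝ} (hb : Integrable b μ)
    (hle : ∀ᵐ a ∂μ, ‖applyFun hB (k a) - applyFun hA (k a)‖ ≤ b a) :
    ‖applyFun hB (fun x => ∫ a, k a x ∂μ) - applyFun hA (fun x => ∫ a, k a x ∂μ)‖ ≤
      ∫ a, b a ∂μ := by
  obtain ⟨iA, eA⟩ := applyFun_integral hA hk
  obtain ⟨iB, eB⟩ := applyFun_integral hB hk
  rw [eA, eB, ← integral_sub iB iA]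
  exact norm_integral_le_of_norm_le hb hle

theorem norm_applyFun_sq_sub_le (hA : A.IsHermitian) (hB : B.IsHermitian) (f : ℝ → ℂ)
    (h1 : ‖applyFun hA f‖ ≤ 1) (h2 : ‖applyFun hB f‖ ≤ 1) :
    ‖applyFun hB (fun x => f x ^ 2) - applyFun hA (fun x => f x ^ 2)‖ ≤
      2 * ‖applyFun hB f - applyFun hA f‖ := by
  simp only [pow_two, ← applyFun_mul]
  set X := applyFun hB f
  set Y := applyFun hA f
  have : X * X - Y * Y = X * (X - Y) + (X - Y) * Y := by
    rw [Matrix.mul_sub, Matrix.sub_mul]; abel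
  rw [this]
  calc ‖X * (X - Y) + (X - Y) * Y‖ ≤ ‖X‖ * ‖X - Y‖ + ‖X - Y‖ * ‖Y‖ :=
        (norm_add_le _ _).trans (add_le_add (norm_mul_le _ _) (norm_mul_le _ _))
    _ ≤ 1 * ‖X - Y‖ + ‖X - Y‖ * 1 := by gcongr
    _ = 2 * ‖X - Y‖ := by ring

/-- The constant by which a bound for Lorentzians is multiplied when it is transferred to `χ`. -/
noncomputable def transferConst (χ : ℝ → ℂ) : ℝ :=
  (4 / Real.pi) * (∫ u, ‖χ u‖) + (2 / Real.pi) * ∫ u, ‖deriv (deriv χ) u‖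

theorem transferConst_nonneg (χ : ℝ → ℂ) : 0 ≤ transferConst χ := by
  unfold transferConst
  have h1 : 0 ≤ ∫ u, ‖χ u‖ := integral_nonneg fun _ => norm_nonneg _
  have h2 : 0 ≤ ∫ u, ‖deriv (deriv χ) u‖ := integral_nonneg fun _ => norm_nonneg _
  positivity

theorem lorentz_rescale {δ : ℝ} (hδ : 0 < δ) (E u s x : ℝ) :
    lorentz u s ((x - E) / δ) = lorentz (E + δ * u) (δ * s) x := by
  have h1 : (x - (E + δ * u)) ^ 2 = δ ^ 2 * ((x - E) / δ - u) ^ 2 := by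
    field_simp; ring
  rw [lorentz, lorentz, h1, mul_pow, ← mul_add, mul_div_mul_left _ _ (by positivity)]

theorem integrableOn_rpow_neg_half :
    IntegrableOn (fun s : ℝ => s ^ (-(1 / 2) : ℝ)) (Set.Ioc 0 1) := by
  rw [← intervalIntegrable_iff_integrableOn_Ioc_of_le zero_le_one]
  exact intervalIntegral.intervalIntegrable_rpow' (by norm_num)

theorem integral_rpow_neg_half : ∫ s in Set.Ioc (0 : ℝ) 1, s ^ (-(1 / 2) : ℝ) = 2 := by
  rw [← intervalIntegral.integral_of_le zero_le_one, integral_rpow (Or.inl (by norm_num))]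
  norm_num

/-- A bound for the difference of all Lorentzians of `A` and `B` of order `s^{-1/2}` in their width
`s` gives the same bound, up to a constant, for every rescaled test function. The integrability of
`s^{-1/2}` at the origin is what makes two derivatives of `χ` suffice. -/
theorem norm_rescale_sub_le_of_lorentz {χ : ℝ → ℂ} (hχ : ContDiff ℝ 2 χ) (hs : HasCompactSupport χ)
    (hA : A.IsHermitian) (hB : B.IsHermitian) {τ : ℝ}
    (h : ∀ u s : ℝ, 0 < s → ‖applyFun hB (fun x => (lorentz u s x : ℂ)) -
      applyFun hA (fun x => (lorentz u s x : ℂ))‖ ≤ τ * s ^ (-(1 / 2) : ℝ))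
    (E : ℝ) {δ : ℝ} (hδ : 0 < δ) :
    ‖applyFun hB (rescale χ δ E) - applyFun hA (rescale χ δ E)‖ ≤
      transferConst χ * τ * δ ^ (-(1 / 2) : ℝ) := by
  have hχ1 : ContDiff ℝ 1 (deriv χ) := by
    have : ContDiff ℝ (1 + 1) χ := by simpa [one_add_one_eq_two] using hχ
    exact (contDiff_succ_iff_deriv.1 this).2.2
  have hc : Continuous (deriv (deriv χ)) := hχ1.continuous_deriv le_rfl
  have hs2 := hs.deriv.deriv
  set T := τ * δ ^ (-(1 / 2) : ℝ) with hT
  set k₁ : ℝ → ℝ → ℂ := fun u x =>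
    ((2 / Real.pi : ℝ) : ℂ) * χ u * ((lorentz u 1 ((x - E) / δ) : ℝ) : ℂ) ^ 2 with hk₁
  set k₂ : ℝ → ℝ → ℂ := fun u x => ((1 / Real.pi : ℝ) : ℂ) * deriv (deriv χ) u *
    (lorentzProfile |(x - E) / δ - u| : ℂ) with hk₂
  have hf : rescale χ δ E = fun x => (∫ u, k₁ u x) - ∫ u, k₂ u x :=
    funext fun x => eq_integral_lorentz hχ hs ((x - E) / δ)
  have i₁ : ∀ x, Integrable fun u => k₁ u x := fun x => by
    have hl : Continuous fun u => ((lorentz u 1 ((x - E) / δ) : ℝ) : ℂ) ^ 2 := by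
      refine (Complex.continuous_ofReal.comp ?_).pow 2
      unfold lorentz
      refine Continuous.div (by fun_prop) (by fun_prop) fun u => ?_
      positivity
    exact ((continuous_const.mul hχ.continuous).mul hl).integrable_of_hasCompactSupport
      (hs.mul_left.mul_right)
  have i₂ : ∀ x, Integrable fun u => k₂ u x := fun x => by
    have hl : Continuous fun u => ((lorentzProfile |(x - E) / δ - u| : ℝ) : ℂ) :=
      Complex.continuous_ofReal.comp (continuous_lorentzProfile.comp (by fun_prop))
    exact ((continuous_const.mul hc).mul hl).integrable_of_hasCompactSupport
      (hs2.mul_left.mul_right)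
  have n₁ : ∀ u, ‖applyFun hB (k₁ u) - applyFun hA (k₁ u)‖ ≤ (4 / Real.pi * T) * ‖χ u‖ := by
    intro u
    have e : k₁ u = fun x => ((2 / Real.pi : ℝ) : ℂ) * χ u *
        ((lorentz (E + δ * u) δ x : ℝ) : ℂ) ^ 2 := by
      ext x; simp only [hk₁, lorentz_rescale hδ, mul_one]
    rw [e, ← applyFun_smul, ← applyFun_smul, ← smul_sub, norm_smul, norm_mul, Complex.norm_real,
      Real.norm_of_nonneg (by positivity)]
    have := norm_applyFun_sq_sub_le hA hB (fun x => ((lorentz (E + δ * u) δ x : ℝ) : ℂ))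
      (norm_applyFun_lorentz_le hA _ _) (norm_applyFun_lorentz_le hB _ _)
    calc _ ≤ 2 / Real.pi * ‖χ u‖ * (2 * T) := by
          gcongr
          exact this.trans (mul_le_mul_of_nonneg_left (h _ _ hδ) zero_le_two)
      _ = (4 / Real.pi * T) * ‖χ u‖ := by ring
  have n₂ : ∀ u, ‖applyFun hB (k₂ u) - applyFun hA (k₂ u)‖ ≤
      (2 / Real.pi * T) * ‖deriv (deriv χ) u‖ := by
    intro u
    have e : k₂ u = fun x => ((1 / Real.pi : ℝ) : ℂ) * deriv (deriv χ) u *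
        ∫ s in Set.Ioc (0 : ℝ) 1, ((lorentz (E + δ * u) (δ * s) x : ℝ) : ℂ) := by
      ext x
      simp only [hk₂, ← integral_lorentz, ← lorentz_rescale hδ, integral_complex_ofReal]
    rw [e, ← applyFun_smul, ← applyFun_smul, ← smul_sub, norm_smul, norm_mul, Complex.norm_real,
      Real.norm_of_nonneg (by positivity)]
    have hint : ∀ x, Integrable (fun s : ℝ => ((lorentz (E + δ * u) (δ * s) x : ℝ) : ℂ))
        (volume.restrict (Set.Ioc 0 1)) := fun x => by
      simp only [← lorentz_rescale hδ]
      exact (integrableOn_lorentz _ _).ofReal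
    have := norm_applyFun_integral_sub_le hA hB hint
      (b := fun s => T * s ^ (-(1 / 2) : ℝ)) (integrableOn_rpow_neg_half.const_mul T)
      ((ae_restrict_iff' measurableSet_Ioc).2 (Filter.Eventually.of_forall fun s hs => by
        refine (h _ _ (mul_pos hδ hs.1)).trans_eq ?_
        rw [Real.mul_rpow hδ.le hs.1.le, hT]; ring))
    rw [integral_const_mul, integral_rpow_neg_half] at this
    calc _ ≤ 1 / Real.pi * ‖deriv (deriv χ) u‖ * (T * 2) := by gcongr
      _ = (2 / Real.pi * T) * ‖deriv (deriv χ) u‖ := by ring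
  have b₁ := norm_applyFun_integral_sub_le hA hB i₁
    ((hχ.continuous.integrable_of_hasCompactSupport hs).norm.const_mul (4 / Real.pi * T))
    (Filter.Eventually.of_forall n₁)
  have b₂ := norm_applyFun_integral_sub_le hA hB i₂
    ((hc.integrable_of_hasCompactSupport hs2).norm.const_mul (2 / Real.pi * T))
    (Filter.Eventually.of_forall n₂)
  rw [integral_const_mul] at b₁ b₂
  rw [hf, ← applyFun_sub, ← applyFun_sub, sub_sub_sub_comm]
  calc _ ≤ 4 / Real.pi * T * (∫ u, ‖χ u‖) + 2 / Real.pi * T * ∫ u, ‖deriv (deriv χ) u‖ :=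
        (norm_sub_le _ _).trans (add_le_add b₁ b₂)
    _ = transferConst χ * τ * δ ^ (-(1 / 2) : ℝ) := by rw [transferConst, hT]; ring

end Transfer


/-! ### Trace inequalities -/

section Trace

open scoped Matrix.Norms.L2Operator

variable {n : Type*} [Fintype n] [DecidableEq n] {X : Matrix n n ℂ}

theorem applyFun_pow (hX : X.IsHermitian) (k : ℕ) : applyFun hX (fun x => (x : ℂ) ^ k) = X ^ k := by
  induction k with
  | zero => simp [applyFun_one]
  | succ k ih =>
    simp only [pow_succ]
    rw [← applyFun_mul, ih, applyFun_ofReal]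

/-- The matrix `M` in the eigenbasis of `X`. -/
noncomputable def inEigenbasis (hX : X.IsHermitian) (M : Matrix n n ℂ) : Matrix n n ℂ :=
  star (hX.eigenvectorUnitary : Matrix n n ℂ) * M * (hX.eigenvectorUnitary : Matrix n n ℂ)

theorem inEigenbasis_mul (hX : X.IsHermitian) (M N : Matrix n n ℂ) :
    inEigenbasis hX (M * N) = inEigenbasis hX M * inEigenbasis hX N := by
  simp only [inEigenbasis]
  set U : Matrix n n ℂ := (hX.eigenvectorUnitary : Matrix n n ℂ)
  have h : U * star U = 1 := eigenvectorUnitary_mul_star hX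
  calc star U * (M * N) * U = star U * M * (U * star U) * N * U := by
        rw [h, Matrix.mul_one]; simp only [Matrix.mul_assoc]
    _ = _ := by simp only [Matrix.mul_assoc]

theorem inEigenbasis_isHermitian (hX : X.IsHermitian) {M : Matrix n n ℂ} (hM : M.IsHermitian) :
    (inEigenbasis hX M).IsHermitian :=
  Matrix.isHermitian_conjTranspose_mul_mul _ hM

theorem inEigenbasis_pow (hX : X.IsHermitian) (k : ℕ) :
    inEigenbasis hX (X ^ k) = Matrix.diagonal fun j => (hX.eigenvalues j : ℂ) ^ k := by
  rw [← applyFun_pow hX, inEigenbasis, applyFun]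
  set U : Matrix n n ℂ := (hX.eigenvectorUnitary : Matrix n n ℂ)
  have h : star U * U = 1 := star_eigenvectorUnitary_mul hX
  simp only [Matrix.mul_assoc, h, Matrix.mul_one]
  rw [← Matrix.mul_assoc, h, Matrix.one_mul]

theorem trace_inEigenbasis (hX : X.IsHermitian) (M : Matrix n n ℂ) :
    (inEigenbasis hX M).trace = M.trace := by
  rw [inEigenbasis, Matrix.trace_mul_comm, ← Matrix.mul_assoc, eigenvectorUnitary_mul_star,
    Matrix.one_mul]

theorem norm_inEigenbasis (hX : X.IsHermitian) (M : Matrix n n ℂ) : ‖inEigenbasis hX M‖ = ‖M‖ := by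
  have := norm_conj_unitary (U := star (hX.eigenvectorUnitary : Matrix n n ℂ))
    (by rw [star_star]; exact star_eigenvectorUnitary_mul hX) M
  rwa [star_star] at this

theorem norm_apply_self_le (M : Matrix n n ℂ) (j : n) : ‖M j j‖ ≤ ‖M‖ := by
  have h := Matrix.l2_opNorm_mulVec M (EuclideanSpace.single j (1 : ℂ))
  rw [PiLp.norm_single, norm_one, mul_one] at h
  refine le_trans ?_ h
  have h2 := PiLp.norm_apply_le (WithLp.toLp 2 (M.mulVec (EuclideanSpace.single j (1 : ℂ)).ofLp)) j
  refine le_trans (le_of_eq ?_) h2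
  simp

theorem trace_pow_even_re (hX : X.IsHermitian) (p : ℕ) :
    (X ^ (2 * p)).trace.re = ∑ j, hX.eigenvalues j ^ (2 * p) := by
  rw [← trace_inEigenbasis hX, inEigenbasis_pow, Matrix.trace_diagonal, Complex.re_sum]
  refine Finset.sum_congr rfl fun j _ => ?_
  rw [← Complex.ofReal_pow, Complex.ofReal_re]

theorem trace_pow_even_re_nonneg (hX : X.IsHermitian) (p : ℕ) : 0 ≤ (X ^ (2 * p)).trace.re := by
  rw [trace_pow_even_re hX]
  exact Finset.sum_nonneg fun j _ => (even_two_mul p).pow_nonneg _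

theorem norm_pow_le_trace (hX : X.IsHermitian) {p : ℕ} (hp : p ≠ 0) :
    ‖X‖ ^ (2 * p) ≤ (X ^ (2 * p)).trace.re := by
  have h0 := trace_pow_even_re_nonneg hX p
  have h2p : 2 * p ≠ 0 := by omega
  have h : ‖X‖ ≤ ((X ^ (2 * p)).trace.re) ^ (((2 * p : ℕ) : ℝ)⁻¹) := by
    conv_lhs => rw [← applyFun_ofReal hX]
    refine norm_applyFun_le hX _ (Real.rpow_nonneg h0 _) fun j => ?_
    rw [Complex.norm_real, Real.norm_eq_abs]
    rw [Real.le_rpow_inv_iff_of_pos (abs_nonneg _) h0 (by positivity), Real.rpow_natCast,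
      (even_two_mul p).pow_abs, trace_pow_even_re hX]
    exact Finset.single_le_sum (f := fun j => hX.eigenvalues j ^ (2 * p))
      (fun j _ => (even_two_mul p).pow_nonneg _) (Finset.mem_univ j)
  calc ‖X‖ ^ (2 * p) ≤ (((X ^ (2 * p)).trace.re) ^ (((2 * p : ℕ) : ℝ)⁻¹)) ^ (2 * p) := by gcongr
    _ = (X ^ (2 * p)).trace.re := Real.rpow_inv_natCast_pow h0 h2p

theorem trace_mul_pow_re_le (hX : X.IsHermitian) (S : Matrix n n ℂ) (p : ℕ) :
    (S * X ^ (2 * p)).trace.re ≤ ‖S‖ * (X ^ (2 * p)).trace.re := by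
  rw [trace_pow_even_re hX, ← trace_inEigenbasis hX, inEigenbasis_mul, inEigenbasis_pow,
    Matrix.trace, Complex.re_sum, Finset.mul_sum]
  refine Finset.sum_le_sum fun j _ => ?_
  rw [Matrix.diag_apply, Matrix.mul_diagonal, ← Complex.ofReal_pow, Complex.re_mul_ofReal]
  refine mul_le_mul_of_nonneg_right ?_ ((even_two_mul p).pow_nonneg _)
  exact (Complex.re_le_norm _).trans ((norm_apply_self_le _ j).trans_eq (norm_inEigenbasis hX S))

theorem pow_mul_pow_le_add {a b : ℝ} {q r p : ℕ} (h : q + r = 2 * p) :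
    a ^ q * b ^ r ≤ a ^ (2 * p) + b ^ (2 * p) := by
  have key : ∀ {x y : ℝ}, 0 ≤ x → 0 ≤ y → x ≤ y → x ^ q * y ^ r ≤ y ^ (2 * p) := by
    intro x y hx hy hxy
    rw [← h, pow_add]
    gcongr
  have key' : ∀ {x y : ℝ}, 0 ≤ x → 0 ≤ y → y ≤ x → x ^ q * y ^ r ≤ x ^ (2 * p) := by
    intro x y hx hy hxy
    rw [← h, pow_add]
    gcongr
  have ha : 0 ≤ a ^ (2 * p) := (even_two_mul p).pow_nonneg _
  have hb : 0 ≤ b ^ (2 * p) := (even_two_mul p).pow_nonneg _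
  refine (le_abs_self _).trans ?_
  rw [abs_mul, abs_pow, abs_pow]
  rcases le_total |a| |b| with hab | hab
  · have := key (abs_nonneg a) (abs_nonneg b) hab
    rw [(even_two_mul p).pow_abs] at this
    linarith
  · have := key' (abs_nonneg a) (abs_nonneg b) hab
    rw [(even_two_mul p).pow_abs] at this
    linarith

/-- Moving all powers of `X` together only increases the trace, up to the factor `2`. In the
eigenbasis of `X` the left-hand side is `∑ |A i j|² x_j ^ q x_i ^ r`. -/
theorem trace_mul_pow_mul_pow_re_le (hX : X.IsHermitian) {A : Matrix n n ℂ} (hA : A.IsHermitian)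
    {q r p : ℕ} (h : q + r = 2 * p) :
    (A * (X ^ q * A * X ^ r)).trace.re ≤ 2 * (A * A * X ^ (2 * p)).trace.re := by
  set B := inEigenbasis hX A with hB
  set e := hX.eigenvalues
  have hBH := inEigenbasis_isHermitian hX hA
  rw [← hB] at hBH
  have hBn : ∀ i j, B i j * B j i = ((‖B i j‖ ^ 2 : ℝ) : ℂ) := fun i j => by
    rw [← hBH.apply j i, Complex.star_def, Complex.mul_conj, Complex.normSq_eq_norm_sq]
  have hsymm : ∀ i j, ‖B i j‖ = ‖B j i‖ := fun i j => by
    rw [← hBH.apply i j, norm_star]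
  have h1 : (A * (X ^ q * A * X ^ r)).trace.re = ∑ i, ∑ j, ‖B i j‖ ^ 2 * (e j ^ q * e i ^ r) := by
    rw [← trace_inEigenbasis hX]
    simp only [inEigenbasis_mul, inEigenbasis_pow]
    rw [← hB, Matrix.trace, Complex.re_sum]
    refine Finset.sum_congr rfl fun i _ => ?_
    rw [Matrix.diag_apply, Matrix.mul_apply, Complex.re_sum]
    refine Finset.sum_congr rfl fun j _ => ?_
    rw [Matrix.mul_diagonal, Matrix.diagonal_mul]
    have : B i j * ((e j : ℂ) ^ q * B j i * (e i : ℂ) ^ r) =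
        ((‖B i j‖ ^ 2 * (e j ^ q * e i ^ r) : ℝ) : ℂ) := by
      rw [Complex.ofReal_mul, ← hBn]; push_cast; ring
    rw [this, Complex.ofReal_re]
  have h2 : (A * A * X ^ (2 * p)).trace.re = ∑ i, ∑ j, ‖B i j‖ ^ 2 * e i ^ (2 * p) := by
    rw [← trace_inEigenbasis hX]
    simp only [inEigenbasis_mul, inEigenbasis_pow]
    rw [← hB, Matrix.trace, Complex.re_sum]
    refine Finset.sum_congr rfl fun i _ => ?_
    rw [Matrix.diag_apply, Matrix.mul_diagonal, Matrix.mul_apply, Finset.sum_mul, Complex.re_sum]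
    refine Finset.sum_congr rfl fun j _ => ?_
    rw [hBn, ← Complex.ofReal_pow, ← Complex.ofReal_mul, Complex.ofReal_re]
  have h3 : ∑ i, ∑ j, ‖B i j‖ ^ 2 * e j ^ (2 * p) = ∑ i, ∑ j, ‖B i j‖ ^ 2 * e i ^ (2 * p) := by
    rw [Finset.sum_comm]
    simp only [hsymm]
  rw [h1, two_mul, h2]
  nth_rewrite 1 [← h3]
  rw [← Finset.sum_add_distrib]
  refine Finset.sum_le_sum fun i _ => ?_
  rw [← Finset.sum_add_distrib]
  refine Finset.sum_le_sum fun j _ => ?_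
  rw [← mul_add]
  exact mul_le_mul_of_nonneg_left (pow_mul_pow_le_add h) (sq_nonneg _)

end Trace

/-! ### Gaussian integration by parts -/

section Moments

theorem memLp_mul_of_forall {S R : Type*} [MeasurableSpace S] {μ : Measure S} [NormedRing R]
    {f g : S → R} (hf : ∀ p : ℕ, MemLp f p μ) (hg : ∀ p : ℕ, MemLp g p μ) (p : ℕ) :
    MemLp (fun a => f a * g a) p μ := by
  have : ENNReal.HolderTriple ((2 * p : ℕ) : ENNReal) ((2 * p : ℕ) : ENNReal) (p : ENNReal) := by
    constructor
    push_cast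
    rw [ENNReal.mul_inv (Or.inl two_ne_zero) (Or.inl ENNReal.ofNat_ne_top), ← add_mul,
      ENNReal.inv_two_add_inv_two, one_mul]
  exact (hg (2 * p)).mul' (hf (2 * p))

theorem memLp_pow_of_forall {S R : Type*} [MeasurableSpace S] {μ : Measure S} [IsFiniteMeasure μ]
    [NormedRing R] {f : S → R} (hf : ∀ p : ℕ, MemLp f p μ) (k p : ℕ) :
    MemLp (fun a => f a ^ k) p μ := by
  induction k generalizing p with
  | zero => simpa using memLp_const (1 : R)
  | succ k ih =>
    simp only [pow_succ]
    exact memLp_mul_of_forall ih hf p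

/-- Stein's identity for the standard Gaussian. -/
theorem integral_mul_gaussianReal {f f' : ℝ → ℝ} (hd : ∀ t, HasDerivAt f (f' t) t)
    (h0 : Integrable f (gaussianReal 0 1)) (h1 : Integrable (fun t => t * f t) (gaussianReal 0 1))
    (h2 : Integrable f' (gaussianReal 0 1)) :
    ∫ t, t * f t ∂gaussianReal 0 1 = ∫ t, f' t ∂gaussianReal 0 1 := by
  have hint : ∀ {g : ℝ → ℝ}, Integrable g (gaussianReal 0 1) →
      Integrable fun t => gaussianPDFReal 0 1 t * g t := by
    intro g hg
    rw [gaussianReal_of_var_ne_zero _ one_ne_zero,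
      integrable_withDensity_iff_integrable_smul' (measurable_gaussianPDF _ _)
        (Filter.Eventually.of_forall fun _ => gaussianPDF_lt_top)] at hg
    simpa [toReal_gaussianPDF] using hg
  have hpdf : ∀ t, HasDerivAt (gaussianPDFReal 0 1) (-t * gaussianPDFReal 0 1 t) t := by
    intro t
    have h : HasDerivAt (fun x : ℝ => -(x - 0) ^ 2 / (2 * ((1 : NNReal) : ℝ))) (-t) t := by
      have := (((hasDerivAt_id t).sub_const 0).fun_pow 2).fun_neg.div_const (2 * ((1 : NNReal) : ℝ))
      refine this.congr_deriv ?_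
      simp only [id, NNReal.coe_one]
      push_cast
      ring
    have h' := h.exp.const_mul ((Real.sqrt (2 * Real.pi * ((1 : NNReal) : ℝ)))⁻¹)
    rw [gaussianPDFReal_def]
    refine h'.congr_deriv ?_
    ring
  have hF : ∀ t, HasDerivAt (fun t => gaussianPDFReal 0 1 t * f t)
      (gaussianPDFReal 0 1 t * f' t - gaussianPDFReal 0 1 t * (t * f t)) t := by
    intro t
    refine ((hpdf t).mul (hd t)).congr_deriv ?_
    ring
  have := integral_eq_zero_of_hasDerivAt_of_integrable hF ((hint h2).sub (hint h1)) (hint h0)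
  rw [integral_sub (hint h2) (hint h1)] at this
  rw [integral_gaussianReal_eq_integral_smul one_ne_zero,
    integral_gaussianReal_eq_integral_smul one_ne_zero]
  simp only [smul_eq_mul]
  linarith

/-- Resampling one coordinate of a product probability measure does not change its law. -/
theorem measurePreserving_update {ι : Type*} [Fintype ι] [DecidableEq ι] (γ : Measure ℝ)
    [IsProbabilityMeasure γ] (i : ι) :
    MeasurePreserving (fun p : (ι → ℝ) × ℝ => Function.update p.1 i p.2)
      ((Measure.pi fun _ : ι => γ).prod γ) (Measure.pi fun _ : ι => γ) := by
  have hm : Measurable (fun p : (ι → ℝ) × ℝ => Function.update p.1 i p.2) := by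
    refine measurable_pi_iff.2 fun j => ?_
    by_cases h : j = i
    · subst h; simpa using measurable_snd
    · simpa [Function.update_of_ne h, Function.comp_def] using
        (measurable_pi_apply j).comp measurable_fst
  refine ⟨hm, (Measure.pi_eq fun s hs => ?_).symm⟩
  rw [Measure.map_apply hm (MeasurableSet.univ_pi hs)]
  have : (fun p : (ι → ℝ) × ℝ => Function.update p.1 i p.2) ⁻¹' Set.univ.pi s =
      (Set.univ.pi (Function.update s i Set.univ)) ×ˢ s i := by
    ext ⟨g, t⟩
    simp only [Set.mem_preimage, Set.mem_pi, Set.mem_univ, true_implies, Set.mem_prod]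
    constructor
    · intro h
      refine ⟨fun j => ?_, by simpa using h i⟩
      by_cases hj : j = i
      · subst hj; simp
      · simpa [Function.update_of_ne hj] using h j
    · rintro ⟨h1, h2⟩ j
      by_cases hj : j = i
      · subst hj; simpa using h2
      · simpa [Function.update_of_ne hj] using h1 j
  rw [this, Measure.prod_prod, Measure.pi_pi, ← Finset.mul_prod_erase _ _ (Finset.mem_univ i),
    ← Finset.mul_prod_erase Finset.univ (fun j => γ (s j)) (Finset.mem_univ i)]
  rw [Function.update_self, measure_univ, one_mul, mul_comm]
  congr 1
  refine Finset.prod_congr rfl fun j hj => ?_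
  rw [Function.update_of_ne (Finset.ne_of_mem_erase hj)]

end Moments

/-! ### Norms of Gaussian matrix series -/

section Series

open scoped Matrix.Norms.L2Operator

variable {n : Type*} [Fintype n] [DecidableEq n]

/-- The real part of the trace as a real-linear continuous functional. -/
noncomputable def traceRe : Matrix n n ℂ →L[ℝ] ℝ :=
  LinearMap.toContinuousLinearMap
    (Complex.reLm ∘ₗ ((Matrix.traceLinearMap n ℂ ℂ).restrictScalars ℝ))

/-- Stein's identity along a line of matrices. -/
theorem integral_mul_trace_line (A B : Matrix n n ℂ) (k : ℕ) :
    ∫ t, t * (A * (B + (t : ℂ) • A) ^ k).trace.re ∂gaussianReal 0 1 =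
      ∫ t, ∑ q ∈ Finset.range k, (A * ((B + (t : ℂ) • A) ^ (k - 1 - q) * A *
        (B + (t : ℂ) • A) ^ q)).trace.re ∂gaussianReal 0 1 := by
  set X : ℝ → Matrix n n ℂ := fun t => B + (t : ℂ) • A with hX
  have hXd : ∀ t, HasDerivAt X A t := fun t => by
    have h := ((Complex.ofRealCLM.hasDerivAt (x := t)).smul_const A).const_add B
    rw [Complex.ofRealCLM_apply, Complex.ofReal_one, one_smul] at h
    exact h
  have hid : ∀ p : ℕ, MemLp (fun t : ℝ => t) p (gaussianReal 0 1) := fun p =>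
    memLp_id_gaussianReal' p (ENNReal.natCast_ne_top p)
  have hXm : ∀ p : ℕ, MemLp X p (gaussianReal 0 1) := fun p => by
    refine (memLp_const B).add ?_
    have h2 : MemLp (fun t : ℝ => t • A) p (gaussianReal 0 1) :=
      (ContinuousLinearMap.smulRight (1 : ℝ →L[ℝ] ℝ) A).comp_memLp' (hid p)
    refine h2.congr_norm ?_ (Filter.Eventually.of_forall fun t => ?_)
    · exact (by fun_prop : Continuous fun t : ℝ => (t : ℂ) • A).aestronglyMeasurable
    · rw [norm_smul, norm_smul, Complex.norm_real]
  have hXk := fun k => memLp_pow_of_forall hXm k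
  have hA : ∀ p : ℕ, MemLp (fun _ : ℝ => A) p (gaussianReal 0 1) := fun p => memLp_const A
  have hf : ∀ p : ℕ, MemLp (fun t => traceRe (A * X t ^ k)) p (gaussianReal 0 1) := fun p =>
    ContinuousLinearMap.comp_memLp' (traceRe (n := n)) (memLp_mul_of_forall hA (hXk k) p)
  have hf' : ∀ q, Integrable (fun t => traceRe (A * (X t ^ (k - 1 - q) * A * X t ^ q)))
      (gaussianReal 0 1) := fun q => by
    have := memLp_mul_of_forall hA
      (memLp_mul_of_forall (memLp_mul_of_forall (hXk (k - 1 - q)) hA) (hXk q)) 1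
    rw [Nat.cast_one, memLp_one_iff_integrable] at this
    exact traceRe.integrable_comp this
  refine integral_mul_gaussianReal (f := fun t => traceRe (A * X t ^ k)) (fun t => ?_) ?_ ?_ ?_
  · have h := ((hXd t).fun_pow' k).const_mul A
    have h2 := traceRe.hasFDerivAt.comp_hasDerivAt t h
    refine h2.congr_deriv ?_
    rw [Finset.mul_sum, map_sum]
    rfl
  · simpa [memLp_one_iff_integrable] using hf 1
  · simpa [memLp_one_iff_integrable] using memLp_mul_of_forall hid hf 1
  · exact integrable_finsetSum _ fun q _ => hf' q

variable {ι : Type*} [Fintype ι]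

/-- The matrix series `∑ i, g i • A i`. -/
noncomputable def matrixSeries (A : ι → Matrix n n ℂ) (g : ι → ℝ) : Matrix n n ℂ :=
  ∑ i, (g i : ℂ) • A i

/-- The law of independent standard Gaussian variables. -/
noncomputable abbrev stdGaussianPi (ι : Type*) [Fintype ι] : Measure (ι → ℝ) :=
  Measure.pi fun _ => gaussianReal 0 1

omit [Fintype n] [DecidableEq n] in
theorem matrixSeries_isHermitian {A : ι → Matrix n n ℂ} (hA : ∀ i, (A i).IsHermitian)
    (g : ι → ℝ) : (matrixSeries A g).IsHermitian := by
  rw [matrixSeries, Matrix.IsHermitian, Matrix.conjTranspose_sum]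
  refine Finset.sum_congr rfl fun i _ => ?_
  rw [Matrix.conjTranspose_smul, (hA i).eq]
  simp

theorem memLp_coord (i : ι) (p : ℕ) : MemLp (fun g : ι → ℝ => g i) p (stdGaussianPi ι) :=
  (memLp_id_gaussianReal' (p : ENNReal) (ENNReal.natCast_ne_top p)).comp_measurePreserving
    (measurePreserving_eval (fun _ : ι => gaussianReal 0 1) i)

theorem memLp_matrixSeries (A : ι → Matrix n n ℂ) (p : ℕ) :
    MemLp (matrixSeries A) p (stdGaussianPi ι) := by
  have : matrixSeries A = fun g => ∑ i, (g i : ℂ) • A i := rfl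
  rw [this]
  refine memLp_finsetSum _ fun i _ => ?_
  have h2 : MemLp (fun g : ι → ℝ => g i • A i) p (stdGaussianPi ι) :=
    (ContinuousLinearMap.smulRight (1 : ℝ →L[ℝ] ℝ) (A i)).comp_memLp' (memLp_coord i p)
  refine h2.congr_norm ?_ (Filter.Eventually.of_forall fun t => ?_)
  · exact (by fun_prop : Continuous fun g : ι → ℝ => (g i : ℂ) • A i).aestronglyMeasurable
  · rw [norm_smul, norm_smul, Complex.norm_real]

theorem integrable_trace_pow (A : ι → Matrix n n ℂ) (M : Matrix n n ℂ) (k : ℕ) :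
    Integrable (fun g => (M * matrixSeries A g ^ k).trace.re) (stdGaussianPi ι) := by
  have := memLp_mul_of_forall (fun p : ℕ => memLp_const (μ := stdGaussianPi ι) (p := p) M)
    (memLp_pow_of_forall (memLp_matrixSeries A) k) 1
  rw [Nat.cast_one, memLp_one_iff_integrable] at this
  exact traceRe.integrable_comp this

theorem integrable_trace_pow_mul_pow (A : ι → Matrix n n ℂ) (M N : Matrix n n ℂ) (k l : ℕ) :
    Integrable (fun g => (M * (matrixSeries A g ^ k * N * matrixSeries A g ^ l)).trace.re)
      (stdGaussianPi ι) := by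
  have hc := fun (M : Matrix n n ℂ) (p : ℕ) => memLp_const (μ := stdGaussianPi ι) (p := p) M
  have hp := memLp_pow_of_forall (memLp_matrixSeries A)
  have := memLp_mul_of_forall (hc M)
    (memLp_mul_of_forall (memLp_mul_of_forall (hp k) (hc N)) (hp l)) 1
  rw [Nat.cast_one, memLp_one_iff_integrable] at this
  exact traceRe.integrable_comp this

theorem integrable_coord_mul_trace_pow (A : ι → Matrix n n ℂ) (i : ι) (M : Matrix n n ℂ) (k : ℕ) :
    Integrable (fun g => g i * (M * matrixSeries A g ^ k).trace.re) (stdGaussianPi ι) := by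
  have := memLp_mul_of_forall (memLp_coord i) (fun p : ℕ => traceRe.comp_memLp'
    (memLp_mul_of_forall (fun p : ℕ => memLp_const (μ := stdGaussianPi ι) (p := p) M)
      (memLp_pow_of_forall (memLp_matrixSeries A) k) p)) 1
  rwa [Nat.cast_one, memLp_one_iff_integrable] at this

variable [DecidableEq ι]

omit [Fintype n] [DecidableEq n] in
theorem matrixSeries_update (A : ι → Matrix n n ℂ) (g : ι → ℝ) (i : ι) (t : ℝ) :
    matrixSeries A (Function.update g i t) =
      (∑ j ∈ Finset.univ.erase i, (g j : ℂ) • A j) + (t : ℂ) • A i := by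
  rw [matrixSeries, ← Finset.sum_erase_add _ _ (Finset.mem_univ i), Function.update_self]
  congr 1
  refine Finset.sum_congr rfl fun j hj => ?_
  rw [Function.update_of_ne (Finset.ne_of_mem_erase hj)]

theorem integral_coord_mul_trace_pow (A : ι → Matrix n n ℂ) (i : ι) (k : ℕ) :
    ∫ g, g i * (A i * matrixSeries A g ^ k).trace.re ∂stdGaussianPi ι =
      ∫ g, ∑ q ∈ Finset.range k, (A i * (matrixSeries A g ^ (k - 1 - q) * A i *
        matrixSeries A g ^ q)).trace.re ∂stdGaussianPi ι := by
  have hmp := measurePreserving_update (gaussianReal 0 1) i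
  have resample : ∀ {F : (ι → ℝ) → ℝ}, Integrable F (stdGaussianPi ι) →
      ∫ g, F g ∂stdGaussianPi ι =
        ∫ g, ∫ t, F (Function.update g i t) ∂gaussianReal 0 1 ∂stdGaussianPi ι := by
    intro F hF
    have hF' := hF
    rw [stdGaussianPi, ← hmp.map_eq] at hF'
    conv_lhs => rw [stdGaussianPi, ← hmp.map_eq]
    rw [integral_map hmp.measurable.aemeasurable hF'.aestronglyMeasurable]
    exact integral_prod _ (hmp.integrable_comp_of_integrable hF)
  rw [resample (integrable_coord_mul_trace_pow A i _ k),
    resample (integrable_finsetSum _ fun q _ => integrable_trace_pow_mul_pow A _ _ _ _)]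
  refine integral_congr_ae (Filter.Eventually.of_forall fun g => ?_)
  simp only [matrixSeries_update, Function.update_self]
  exact integral_mul_trace_line _ _ k

/-- The recursion behind the noncommutative Khintchine inequality: integrating by parts in each
Gaussian variable removes two factors from the trace moment. -/
theorem integral_trace_pow_succ_le {A : ι → Matrix n n ℂ} (hA : ∀ i, (A i).IsHermitian) {σ2 : ℝ}
    (hσ : ‖∑ i, A i * A i‖ ≤ σ2) (p : ℕ) :
    ∫ g, (matrixSeries A g ^ (2 * (p + 1))).trace.re ∂stdGaussianPi ι ≤
      2 * (2 * p + 1) * σ2 * ∫ g, (matrixSeries A g ^ (2 * p)).trace.re ∂stdGaussianPi ι := by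
  have h1 : ∀ g, (matrixSeries A g ^ (2 * (p + 1))).trace.re =
      ∑ i, g i * (A i * matrixSeries A g ^ (2 * p + 1)).trace.re := by
    intro g
    rw [show 2 * (p + 1) = (2 * p + 1) + 1 by ring, pow_succ']
    nth_rewrite 1 [matrixSeries]
    rw [Matrix.sum_mul, Matrix.trace_sum, Complex.re_sum]
    refine Finset.sum_congr rfl fun i _ => ?_
    rw [Matrix.smul_mul, Matrix.trace_smul, smul_eq_mul, Complex.re_ofReal_mul]
  simp only [h1]
  rw [integral_finsetSum _ fun i _ => integrable_coord_mul_trace_pow A i _ _]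
  simp only [integral_coord_mul_trace_pow]
  have hi : ∀ i ∈ (Finset.univ : Finset ι), Integrable (fun g => ∑ q ∈ Finset.range (2 * p + 1),
      (A i * (matrixSeries A g ^ (2 * p + 1 - 1 - q) * A i * matrixSeries A g ^ q)).trace.re)
      (stdGaussianPi ι) := fun i _ =>
    integrable_finsetSum _ fun q _ => integrable_trace_pow_mul_pow A _ _ _ _
  have hi2 : Integrable (fun g => (matrixSeries A g ^ (2 * p)).trace.re) (stdGaussianPi ι) := by
    simpa using integrable_trace_pow A 1 (2 * p)
  rw [← integral_finsetSum _ hi, ← integral_const_mul]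
  refine integral_mono (integrable_finsetSum _ hi) (hi2.const_mul _) fun g => ?_
  have hX := matrixSeries_isHermitian hA g
  calc ∑ i, ∑ q ∈ Finset.range (2 * p + 1),
        (A i * (matrixSeries A g ^ (2 * p + 1 - 1 - q) * A i * matrixSeries A g ^ q)).trace.re
      ≤ ∑ i, ∑ q ∈ Finset.range (2 * p + 1),
        2 * (A i * A i * matrixSeries A g ^ (2 * p)).trace.re := by
        refine Finset.sum_le_sum fun i _ => Finset.sum_le_sum fun q hq => ?_
        refine trace_mul_pow_mul_pow_re_le hX (hA i) ?_
        have := Finset.mem_range.1 hq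
        omega
    _ = 2 * (2 * p + 1) * ((∑ i, A i * A i) * matrixSeries A g ^ (2 * p)).trace.re := by
        rw [Matrix.sum_mul, Matrix.trace_sum, Complex.re_sum, Finset.mul_sum]
        refine Finset.sum_congr rfl fun i _ => ?_
        rw [Finset.sum_const, Finset.card_range, nsmul_eq_mul]
        push_cast
        ring
    _ ≤ 2 * (2 * p + 1) * (σ2 * (matrixSeries A g ^ (2 * p)).trace.re) := by
        gcongr
        refine (trace_mul_pow_re_le hX _ p).trans ?_
        exact mul_le_mul_of_nonneg_right hσ (trace_pow_even_re_nonneg hX p)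
    _ = 2 * (2 * p + 1) * σ2 * (matrixSeries A g ^ (2 * p)).trace.re := by ring

theorem integral_trace_pow_le {A : ι → Matrix n n ℂ} (hA : ∀ i, (A i).IsHermitian) {σ2 : ℝ}
    (hσ : ‖∑ i, A i * A i‖ ≤ σ2) (p : ℕ) :
    ∫ g, (matrixSeries A g ^ (2 * p)).trace.re ∂stdGaussianPi ι ≤
      Fintype.card n * (4 * p * σ2) ^ p := by
  have hσ0 : 0 ≤ σ2 := (norm_nonneg _).trans hσ
  have h : ∀ k ≤ p, ∫ g, (matrixSeries A g ^ (2 * k)).trace.re ∂stdGaussianPi ι ≤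
      Fintype.card n * (4 * p * σ2) ^ k := by
    intro k
    induction k with
    | zero => intro _; simp
    | succ k ih =>
      intro hk
      have hk' : ((k : ℝ) + 1) ≤ p := by exact_mod_cast hk
      have h0 : 0 ≤ ∫ g, (matrixSeries A g ^ (2 * k)).trace.re ∂stdGaussianPi ι :=
        integral_nonneg fun g => trace_pow_even_re_nonneg (matrixSeries_isHermitian hA g) k
      calc _ ≤ 2 * (2 * k + 1) * σ2 * ∫ g, (matrixSeries A g ^ (2 * k)).trace.re ∂stdGaussianPi ι :=
            integral_trace_pow_succ_le hA hσ k
        _ ≤ 4 * p * σ2 * (Fintype.card n * (4 * p * σ2) ^ k) := by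
            refine mul_le_mul ?_ (ih (by omega)) h0 (by positivity)
            exact mul_le_mul_of_nonneg_right (by linarith) hσ0
        _ = Fintype.card n * (4 * p * σ2) ^ (k + 1) := by rw [pow_succ]; ring
  exact h p le_rfl

/-- Tail bound for the norm of a Gaussian matrix series with matrix variance at most `σ2`. -/
theorem measureReal_norm_matrixSeries_ge_le {A : ι → Matrix n n ℂ} (hA : ∀ i, (A i).IsHermitian)
    {σ2 t : ℝ} (hσ : ‖∑ i, A i * A i‖ ≤ σ2) (ht : 0 < t) {p : ℕ} (hp : p ≠ 0) :
    (stdGaussianPi ι).real {g | t ≤ ‖matrixSeries A g‖} ≤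
      Fintype.card n * (4 * p * σ2 / t ^ 2) ^ p := by
  have h1 : {g | t ≤ ‖matrixSeries A g‖} ⊆
      {g | t ^ (2 * p) ≤ (matrixSeries A g ^ (2 * p)).trace.re} := by
    intro g hg
    exact (pow_le_pow_left₀ ht.le hg _).trans
      (norm_pow_le_trace (matrixSeries_isHermitian hA g) hp)
  have hi : Integrable (fun g => (matrixSeries A g ^ (2 * p)).trace.re) (stdGaussianPi ι) := by
    simpa using integrable_trace_pow A 1 (2 * p)
  have h2 := mul_meas_ge_le_integral_of_nonneg (Filter.Eventually.of_forall fun g =>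
    trace_pow_even_re_nonneg (matrixSeries_isHermitian hA g) p) hi (t ^ (2 * p))
  have h3 := h2.trans (integral_trace_pow_le hA hσ p)
  refine (measureReal_mono h1).trans ?_
  have h4 : 0 < t ^ (2 * p) := by positivity
  rw [div_pow, ← pow_mul, ← mul_div_assoc, le_div_iff₀ h4, mul_comm]
  exact h3

end Series


/-! ### The local density of states of the Laplacian -/

section Density

/-- The bound `(π + 1) log ((1 + r) / r)` for averages of `1 / (|sin| + r)`. -/
noncomputable def sinAvgBound (r : ℝ) : ℝ := (Real.pi + 1) * Real.log ((1 + r) / r)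

theorem integral_inv_abs_sin_le {r : ℝ} (hr : 0 < r) :
    ∫ t in (-(1 / 2) : ℝ)..(1 / 2), (|Real.sin (Real.pi * t)| + r)⁻¹ ≤ Real.log ((1 + r) / r) := by
  have hc1 : Continuous fun t : ℝ => (|Real.sin (Real.pi * t)| + r)⁻¹ :=
    Continuous.inv₀ (by fun_prop) fun t => by positivity
  have hc2 : Continuous fun t : ℝ => (2 * |t| + r)⁻¹ :=
    Continuous.inv₀ (by fun_prop) fun t => by positivity
  have h1 : ∫ t in (-(1 / 2) : ℝ)..(1 / 2), (|Real.sin (Real.pi * t)| + r)⁻¹ ≤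
      ∫ t in (-(1 / 2) : ℝ)..(1 / 2), (2 * |t| + r)⁻¹ := by
    refine intervalIntegral.integral_mono_on (by norm_num) (hc1.intervalIntegrable _ _)
      (hc2.intervalIntegrable _ _) fun t ht => ?_
    have ht' : |t| ≤ 1 / 2 := abs_le.2 ht
    have h := Real.mul_abs_le_abs_sin (x := Real.pi * t) (by
      rw [abs_mul, abs_of_pos Real.pi_pos]; nlinarith [Real.pi_pos])
    have h' : 2 / Real.pi * |Real.pi * t| = 2 * |t| := by
      rw [abs_mul, abs_of_pos Real.pi_pos]; field_simp
    rw [h'] at h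
    gcongr
  refine h1.trans (le_of_eq ?_)
  have hpos : ∫ t in (0 : ℝ)..(1 / 2), (2 * |t| + r)⁻¹ = Real.log ((1 + r) / r) / 2 := by
    have hd : ∀ t ∈ Set.uIcc (0 : ℝ) (1 / 2),
        HasDerivAt (fun t => Real.log (2 * t + r) / 2) ((2 * |t| + r)⁻¹) t := by
      intro t ht
      rw [Set.uIcc_of_le (by norm_num)] at ht
      have h0 : 2 * t + r ≠ 0 := by linarith [ht.1]
      have h2 : HasDerivAt (fun t : ℝ => 2 * t + r) 2 t := by
        simpa using ((hasDerivAt_id t).const_mul 2).add_const r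
      refine ((h2.log h0).div_const 2).congr_deriv ?_
      rw [abs_of_nonneg ht.1]
      field_simp
    rw [intervalIntegral.integral_eq_sub_of_hasDerivAt hd (hc2.intervalIntegrable _ _),
      Real.log_div (by positivity) hr.ne']
    norm_num
    ring
  have hneg : ∫ t in (-(1 / 2) : ℝ)..0, (2 * |t| + r)⁻¹ = Real.log ((1 + r) / r) / 2 := by
    rw [← hpos]
    have := intervalIntegral.integral_comp_neg (a := (0 : ℝ)) (b := 1 / 2)
      (fun t : ℝ => (2 * |t| + r)⁻¹)
    simpa using this.symm
  rw [← intervalIntegral.integral_add_adjacent_intervals (hc2.intervalIntegrable _ 0)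
    (hc2.intervalIntegrable _ _), hneg, hpos]
  ring

theorem sum_zmod_val {M : Type*} [AddCommMonoid M] (L : ℕ) [NeZero L] (f : ℕ → M) :
    ∑ k : ZMod L, f k.val = ∑ k ∈ Finset.range L, f k := by
  obtain _ | L := L
  · exact absurd rfl (NeZero.ne 0)
  · exact Fin.sum_univ_eq_sum_range f (L + 1)

/-- Averages over the `L` points `π k / L` are compared with an integral, since the function changes
only by a bounded factor over distances at most `π / L ≤ π r`. -/
theorem avg_inv_abs_sin_le (L : ℕ) [NeZero L] {r : ℝ} (hr : 0 < r) (hL : 1 ≤ L * r) (θ : ℝ) :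
    (L : ℝ)⁻¹ * ∑ k : ZMod L, (|Real.sin (Real.pi * k.val / L - θ)| + r)⁻¹ ≤ sinAvgBound r := by
  have hL0 : (0 : ℝ) < L := by exact_mod_cast Nat.pos_of_ne_zero (NeZero.ne L)
  have hπ := Real.pi_pos
  rw [sum_zmod_val L fun k => (|Real.sin (Real.pi * k / L - θ)| + r)⁻¹, Finset.mul_sum]
  set f : ℝ → ℝ := fun t => (|Real.sin (Real.pi * t - θ)| + r)⁻¹ with hf
  have hc : Continuous f := Continuous.inv₀ (by fun_prop) fun t => by positivity
  have hstep : ∀ k ∈ Finset.range L, (L : ℝ)⁻¹ * (|Real.sin (Real.pi * k / L - θ)| + r)⁻¹ ≤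
      (Real.pi + 1) * ∫ t in ((k : ℕ) : ℝ) / L..((k + 1 : ℕ) : ℝ) / L, f t := by
    intro k _
    have hlen : ((k + 1 : ℕ) : ℝ) / L - (k : ℝ) / L = (L : ℝ)⁻¹ := by push_cast; field_simp; ring
    have hle : (k : ℝ) / L ≤ ((k + 1 : ℕ) : ℝ) / L := by
      have := inv_pos.2 hL0
      linarith
    have hconst : (L : ℝ)⁻¹ * (|Real.sin (Real.pi * k / L - θ)| + r)⁻¹ =
        ∫ _ in ((k : ℕ) : ℝ) / L..((k + 1 : ℕ) : ℝ) / L,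
          (|Real.sin (Real.pi * k / L - θ)| + r)⁻¹ := by
      rw [intervalIntegral.integral_const, hlen, smul_eq_mul]
    rw [hconst, ← intervalIntegral.integral_const_mul]
    refine intervalIntegral.integral_mono_on hle (by simp) ((hc.const_mul _).intervalIntegrable _ _)
      fun t ht => ?_
    have hd : |Real.sin (Real.pi * t - θ)| ≤ |Real.sin (Real.pi * k / L - θ)| + Real.pi * r := by
      have h1 : |Real.sin (Real.pi * t - θ) - Real.sin (Real.pi * k / L - θ)| ≤
          |Real.pi * t - θ - (Real.pi * k / L - θ)| := by
        have := Real.lipschitzWith_sin.dist_le_mul (Real.pi * t - θ) (Real.pi * k / L - θ)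
        simpa [Real.dist_eq] using this
      have h2 : |Real.pi * t - θ - (Real.pi * k / L - θ)| ≤ Real.pi * r := by
        have e : Real.pi * t - θ - (Real.pi * k / L - θ) = Real.pi * (t - k / L) := by ring
        rw [e, abs_of_nonneg (mul_nonneg hπ.le (by linarith [ht.1]))]
        refine mul_le_mul_of_nonneg_left ?_ hπ.le
        have h3 : (L : ℝ)⁻¹ ≤ r := by
          rw [inv_le_iff_one_le_mul₀ hL0, mul_comm]; exact hL
        linarith [ht.2]
      have h3 := abs_sub_abs_le_abs_sub (Real.sin (Real.pi * t - θ))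
        (Real.sin (Real.pi * k / L - θ))
      linarith
    have a0 := abs_nonneg (Real.sin (Real.pi * k / L - θ))
    rw [hf]
    simp only
    rw [← div_eq_mul_inv, inv_eq_one_div, div_le_div_iff₀ (by positivity) (by positivity)]
    nlinarith
  refine (Finset.sum_le_sum hstep).trans ?_
  rw [← Finset.mul_sum, sinAvgBound]
  refine mul_le_mul_of_nonneg_left ?_ (by positivity)
  rw [intervalIntegral.sum_integral_adjacent_intervals (a := fun k : ℕ => (k : ℝ) / L)
    fun k _ => hc.intervalIntegrable _ _]
  have hg : Function.Periodic (fun t : ℝ => (|Real.sin (Real.pi * t)| + r)⁻¹) 1 := by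
    intro t
    simp only
    rw [mul_add, mul_one, Real.sin_add_pi, abs_neg]
  have e : ∀ t, f t = (fun t : ℝ => (|Real.sin (Real.pi * t)| + r)⁻¹) (t - θ / Real.pi) := by
    intro t
    simp only [hf]
    rw [mul_sub, mul_div_cancel₀ _ hπ.ne']
  simp only [e]
  rw [intervalIntegral.integral_comp_sub_right (fun t : ℝ => (|Real.sin (Real.pi * t)| + r)⁻¹)]
  have hper := hg.intervalIntegral_add_eq (0 - θ / Real.pi) (-(1 / 2))
  have e1 : (L : ℝ) / L - θ / Real.pi = 0 - θ / Real.pi + 1 := by rw [div_self hL0.ne']; ring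
  rw [Nat.cast_zero, zero_div, e1, hper]
  have := integral_inv_abs_sin_le hr
  norm_num at this ⊢
  exact this

theorem cos_sub_cos_two (α φ : ℝ) :
    |Real.cos (2 * α) - Real.cos (2 * φ)| = 2 * |Real.sin (α - φ)| * |Real.sin (α - -φ)| := by
  rw [Real.cos_sub_cos, abs_mul, abs_mul, abs_neg, abs_two]
  rw [show (2 * α + 2 * φ) / 2 = α - -φ by ring, show (2 * α - 2 * φ) / 2 = α - φ by ring]
  ring

theorem abs_sin_two_le (α φ : ℝ) :
    |Real.sin (2 * φ)| ≤ |Real.sin (α - φ)| + |Real.sin (α - -φ)| := by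
  have e : Real.sin (2 * φ) = Real.sin (α - -φ) * Real.cos (α - φ) -
      Real.cos (α - -φ) * Real.sin (α - φ) := by
    rw [← Real.sin_sub]; congr 1; ring
  rw [e]
  refine (abs_sub _ _).trans ?_
  rw [abs_mul, abs_mul]
  have h1 := Real.abs_cos_le_one (α - φ)
  have h2 := Real.abs_cos_le_one (α - -φ)
  nlinarith [abs_nonneg (Real.sin (α - φ)), abs_nonneg (Real.sin (α - -φ))]

theorem one_sub_cos_two (α : ℝ) : 1 - Real.cos (2 * α) = 2 * |Real.sin (α - 0)| ^ 2 := by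
  rw [sub_zero, sq_abs, Real.cos_two_mul']
  nlinarith [Real.sin_sq_add_cos_sq α]

theorem one_add_cos_two (α : ℝ) :
    1 + Real.cos (2 * α) = 2 * |Real.sin (α - -(Real.pi / 2))| ^ 2 := by
  rw [sub_neg_eq_add, Real.sin_add_pi_div_two, sq_abs, Real.cos_two_mul']
  nlinarith [Real.sin_sq_add_cos_sq α]

variable (L : ℕ) [NeZero L]

/-- The average over `ZMod L`. -/
noncomputable def zmodAvg (f : ZMod L → ℝ) : ℝ := (L : ℝ)⁻¹ * ∑ k, f k

theorem zmodAvg_mono {f g : ZMod L → ℝ} (h : ∀ k, f k ≤ g k) : zmodAvg L f ≤ zmodAvg L g := by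
  unfold zmodAvg
  gcongr with k
  exact h k

theorem zmodAvg_add (f g : ZMod L → ℝ) :
    zmodAvg L (fun k => f k + g k) = zmodAvg L f + zmodAvg L g := by
  simp only [zmodAvg, Finset.sum_add_distrib, mul_add]

theorem zmodAvg_const_mul (c : ℝ) (f : ZMod L → ℝ) :
    zmodAvg L (fun k => c * f k) = c * zmodAvg L f := by
  simp only [zmodAvg, ← Finset.mul_sum]
  ring

/-- `cos (2 π k / L)`, half of the dispersion relation in one dimension. -/
noncomputable def cosMode (k : ZMod L) : ℝ := Real.cos (2 * (Real.pi * k.val / L))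

variable {L} {r : ℝ}

/-- The smoothed one-dimensional density at `v` is at most `1 / √|1 - v| + 1 / √|1 + v|` up to a
logarithm. -/
theorem zmodAvg_inv_cosMode_sub_le (hr : 0 < r) (hr1 : r ≤ 1) (hL : 1 ≤ L * r) (v : ℝ) :
    zmodAvg L (fun k => (|cosMode L k - v| + 3 * r)⁻¹) ≤
      2 * sinAvgBound r * ((Real.sqrt |1 - v| + r)⁻¹ + (Real.sqrt |1 + v| + r)⁻¹) := by
  have H : ∀ θ, zmodAvg L (fun k => (|Real.sin (Real.pi * k.val / L - θ)| + r)⁻¹) ≤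
      sinAvgBound r := avg_inv_abs_sin_le L hr hL
  have hb : 0 ≤ sinAvgBound r := by
    refine le_trans ?_ (H 0)
    unfold zmodAvg
    positivity
  have p1 : 0 < (Real.sqrt |1 - v| + r)⁻¹ := by positivity
  have p2 : 0 < (Real.sqrt |1 + v| + r)⁻¹ := by positivity
  -- outside the band, with `w` the distance to the band edge
  have outer : ∀ (θ w : ℝ), 0 ≤ w → (∀ k : ZMod L, |cosMode L k - v| =
      2 * |Real.sin (Real.pi * k.val / L - θ)| ^ 2 + w) →
      zmodAvg L (fun k => (|cosMode L k - v| + 3 * r)⁻¹) ≤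
        sinAvgBound r * (Real.sqrt w + r)⁻¹ := by
    intro θ w hw h
    calc _ ≤ zmodAvg L (fun k => (Real.sqrt w + r)⁻¹ *
          (|Real.sin (Real.pi * k.val / L - θ)| + r)⁻¹) := by
          refine zmodAvg_mono L fun k => ?_
          rw [h k, ← mul_inv]
          set x := |Real.sin (Real.pi * k.val / L - θ)|
          have hx : 0 ≤ x := abs_nonneg _
          have hs := Real.sq_sqrt hw
          have hs0 := Real.sqrt_nonneg w
          gcongr
          nlinarith [sq_nonneg (Real.sqrt w - x), sq_nonneg (x - r), sq_nonneg (Real.sqrt w - r)]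
      _ ≤ _ := by
          rw [zmodAvg_const_mul, mul_comm]
          gcongr
          exact H θ
  rcases lt_or_ge 1 v with hv | hv
  · have := outer 0 (v - 1) (by linarith) fun k => by
      have := one_sub_cos_two (Real.pi * k.val / L)
      rw [← this, cosMode, abs_of_nonpos (by linarith [Real.cos_le_one (2 * (Real.pi * k.val / L))])]
      ring
    rw [show v - 1 = |1 - v| by rw [abs_of_neg (by linarith)]; ring] at this
    refine this.trans ?_
    nlinarith [mul_nonneg hb p1.le, mul_nonneg hb p2.le]
  rcases lt_or_ge v (-1) with hv' | hv'
  · have := outer (-(Real.pi / 2)) (-1 - v) (by linarith) fun k => by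
      have := one_add_cos_two (Real.pi * k.val / L)
      rw [← this, cosMode,
        abs_of_nonneg (by linarith [Real.neg_one_le_cos (2 * (Real.pi * k.val / L))])]
      ring
    rw [show -1 - v = |1 + v| by rw [abs_of_neg (by linarith)]; ring] at this
    refine this.trans ?_
    nlinarith [mul_nonneg hb p1.le, mul_nonneg hb p2.le]
  -- inside the band, `v = cos (2 φ)` and the difference of cosines factors
  set φ := Real.arccos v / 2 with hφ
  have hvφ : v = Real.cos (2 * φ) := by
    rw [hφ, mul_div_cancel₀ _ two_ne_zero, Real.cos_arccos hv' hv]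
  have hsin : |Real.sin (2 * φ)| = Real.sqrt (1 - v ^ 2) := by
    rw [hφ, mul_div_cancel₀ _ two_ne_zero, Real.sin_arccos, abs_of_nonneg (Real.sqrt_nonneg _)]
  have hmin : (Real.sqrt (1 - v ^ 2) + r)⁻¹ ≤
      (Real.sqrt |1 - v| + r)⁻¹ + (Real.sqrt |1 + v| + r)⁻¹ := by
    rcases le_total 0 v with h0 | h0
    · refine le_trans ?_ (le_add_of_nonneg_right p2.le)
      gcongr
      rw [abs_of_nonneg (by linarith)]
      nlinarith
    · refine le_trans ?_ (le_add_of_nonneg_left p1.le)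
      gcongr
      rw [abs_of_nonneg (by linarith)]
      nlinarith
  have hpt : ∀ k : ZMod L, (|cosMode L k - v| + 3 * r)⁻¹ ≤ (Real.sqrt (1 - v ^ 2) + r)⁻¹ *
      ((|Real.sin (Real.pi * k.val / L - φ)| + r)⁻¹ +
        (|Real.sin (Real.pi * k.val / L - -φ)| + r)⁻¹) := by
    intro k
    rw [hvφ, cosMode, cos_sub_cos_two, ← hvφ, ← hsin]
    have hxy := abs_sin_two_le (Real.pi * k.val / L) φ
    have hx1 := Real.abs_sin_le_one (Real.pi * k.val / L - φ)
    have hy1 := Real.abs_sin_le_one (Real.pi * k.val / L - -φ)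
    set x := |Real.sin (Real.pi * k.val / L - φ)|
    set y := |Real.sin (Real.pi * k.val / L - -φ)|
    have hx : 0 ≤ x := abs_nonneg _
    have hy : 0 ≤ y := abs_nonneg _
    have hz : 0 ≤ |Real.sin (2 * φ)| := abs_nonneg _
    have e1 : (x + r)⁻¹ + (y + r)⁻¹ = (x + y + 2 * r) * ((x + r) * (y + r))⁻¹ := by
      field_simp; ring
    have e2 : (2 * x * y + 3 * r)⁻¹ ≤ ((x + r) * (y + r))⁻¹ := by
      gcongr
      nlinarith [mul_nonneg hx hy]
    have e3 : 1 ≤ (|Real.sin (2 * φ)| + r)⁻¹ * (x + y + 2 * r) := by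
      rw [inv_mul_eq_div, one_le_div₀ (by positivity)]
      linarith
    rw [e1, ← mul_assoc]
    have e4 : 0 ≤ ((x + r) * (y + r))⁻¹ := by positivity
    nlinarith
  calc _ ≤ _ := zmodAvg_mono L hpt
    _ ≤ (Real.sqrt (1 - v ^ 2) + r)⁻¹ * (sinAvgBound r + sinAvgBound r) := by
        rw [zmodAvg_const_mul, zmodAvg_add]
        gcongr
        · exact H φ
        · exact H (-φ)
    _ = 2 * sinAvgBound r * (Real.sqrt (1 - v ^ 2) + r)⁻¹ := by ring
    _ ≤ _ := by gcongr

theorem zmodAvg_inv_sqrt_cosMode_sub_le (hr : 0 < r) (hL : 1 ≤ L * r) (w : ℝ) :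
    zmodAvg L (fun k => (Real.sqrt |cosMode L k - w| + r)⁻¹) ≤ 2 * sinAvgBound r := by
  have H : ∀ θ, zmodAvg L (fun k => (|Real.sin (Real.pi * k.val / L - θ)| + r)⁻¹) ≤
      sinAvgBound r := avg_inv_abs_sin_le L hr hL
  have hb : 0 ≤ sinAvgBound r := by
    refine le_trans ?_ (H 0)
    unfold zmodAvg
    positivity
  have outer : ∀ θ : ℝ, (∀ k : ZMod L, |Real.sin (Real.pi * k.val / L - θ)| ^ 2 ≤
      |cosMode L k - w|) → zmodAvg L (fun k => (Real.sqrt |cosMode L k - w| + r)⁻¹) ≤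
        2 * sinAvgBound r := by
    intro θ h
    refine le_trans (zmodAvg_mono L fun k => ?_) ((H θ).trans (by linarith))
    gcongr
    exact Real.le_sqrt_of_sq_le (h k)
  rcases lt_or_ge 1 w with hw | hw
  · refine outer 0 fun k => ?_
    have := one_sub_cos_two (Real.pi * k.val / L)
    rw [cosMode, abs_sub_comm]
    refine le_trans ?_ (le_abs_self _)
    nlinarith [sq_nonneg |Real.sin (Real.pi * k.val / L - 0)|]
  rcases lt_or_ge w (-1) with hw' | hw'
  · refine outer (-(Real.pi / 2)) fun k => ?_
    have := one_add_cos_two (Real.pi * k.val / L)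
    rw [cosMode]
    refine le_trans ?_ (le_abs_self _)
    nlinarith [sq_nonneg |Real.sin (Real.pi * k.val / L - -(Real.pi / 2))|]
  set φ := Real.arccos w / 2 with hφ
  have hwφ : w = Real.cos (2 * φ) := by
    rw [hφ, mul_div_cancel₀ _ two_ne_zero, Real.cos_arccos hw' hw]
  have hpt : ∀ k : ZMod L, (Real.sqrt |cosMode L k - w| + r)⁻¹ ≤
      (|Real.sin (Real.pi * k.val / L - φ)| + r)⁻¹ +
        (|Real.sin (Real.pi * k.val / L - -φ)| + r)⁻¹ := by
    intro k
    rw [hwφ, cosMode, cos_sub_cos_two]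
    set x := |Real.sin (Real.pi * k.val / L - φ)|
    set y := |Real.sin (Real.pi * k.val / L - -φ)|
    have hx : 0 ≤ x := abs_nonneg _
    have hy : 0 ≤ y := abs_nonneg _
    have p1 : 0 ≤ (x + r)⁻¹ := by positivity
    have p2 : 0 ≤ (y + r)⁻¹ := by positivity
    rcases le_total x y with hxy | hxy
    · refine le_trans ?_ (le_add_of_nonneg_right p2)
      gcongr
      exact Real.le_sqrt_of_sq_le (by nlinarith)
    · refine le_trans ?_ (le_add_of_nonneg_left p1)
      gcongr
      exact Real.le_sqrt_of_sq_le (by nlinarith)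
  calc _ ≤ _ := zmodAvg_mono L hpt
    _ ≤ sinAvgBound r + sinAvgBound r := by
        rw [zmodAvg_add]
        exact add_le_add (H φ) (H (-φ))
    _ = _ := by ring

/-- In two dimensions the smoothed density is bounded by the square of a logarithm. One logarithm
comes from the cut-off and one from the van Hove singularity. -/
theorem zmodAvg_zmodAvg_inv_cosMode_le (hr : 0 < r) (hr1 : r ≤ 1) (hL : 1 ≤ L * r) (u : ℝ) :
    zmodAvg L (fun a => zmodAvg L fun b => (|cosMode L b + cosMode L a - u| + 3 * r)⁻¹) ≤
      8 * sinAvgBound r ^ 2 := by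
  have hb : 0 ≤ sinAvgBound r := by
    unfold sinAvgBound
    have : 0 ≤ Real.log ((1 + r) / r) :=
      Real.log_nonneg ((one_le_div₀ hr).2 (by linarith))
    positivity
  calc _ ≤ zmodAvg L (fun a => 2 * sinAvgBound r *
        ((Real.sqrt |cosMode L a - (u - 1)| + r)⁻¹ +
          (Real.sqrt |cosMode L a - (u + 1)| + r)⁻¹)) := by
        refine zmodAvg_mono L fun a => ?_
        have := zmodAvg_inv_cosMode_sub_le hr hr1 hL (u - cosMode L a)
        rw [show 1 - (u - cosMode L a) = cosMode L a - (u - 1) by ring,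
          show 1 + (u - cosMode L a) = -(cosMode L a - (u + 1)) by ring, abs_neg] at this
        simpa only [sub_sub_eq_add_sub] using this
    _ ≤ 2 * sinAvgBound r * (2 * sinAvgBound r + 2 * sinAvgBound r) := by
        rw [zmodAvg_const_mul, zmodAvg_add]
        gcongr
        · exact zmodAvg_inv_sqrt_cosMode_sub_le hr hL _
        · exact zmodAvg_inv_sqrt_cosMode_sub_le hr hL _
    _ = _ := by ring

variable (L)

/-- The dispersion relation of the Laplacian, `k ↦ ∑ i, 2 cos (2 π k i / L)`. -/
noncomputable def dispersion {d : ℕ} (k : Torus d L) : ℝ := ∑ i, 2 * cosMode L (k i)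

omit [NeZero L] in
theorem abs_dispersion_le {d : ℕ} (k : Torus d L) : |dispersion L k| ≤ 2 * d := by
  refine (Finset.abs_sum_le_sum_abs _ _).trans ?_
  calc ∑ i : Fin d, |2 * cosMode L (k i)| ≤ ∑ _i : Fin d, (2 : ℝ) := by
        refine Finset.sum_le_sum fun i _ => ?_
        rw [abs_mul, abs_two]
        have := Real.abs_cos_le_one (2 * (Real.pi * (k i).val / L))
        unfold cosMode
        linarith
    _ = 2 * d := by simp [mul_comm]

theorem sum_dispersion_succ {m : ℕ} (g : ℝ → ℝ) :
    ∑ k : Torus (m + 1) L, g (dispersion L k) =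
      ∑ k : Torus m L, ∑ a : ZMod L, g (2 * cosMode L a + dispersion L k) := by
  rw [← (Fin.consEquiv fun _ : Fin (m + 1) => ZMod L).sum_comp, Fintype.sum_prod_type,
    Finset.sum_comm]
  refine Finset.sum_congr rfl fun k _ => Finset.sum_congr rfl fun a _ => ?_
  simp only [dispersion, Fin.consEquiv_apply, Fin.sum_univ_succ, Fin.cons_zero, Fin.cons_succ]

theorem avg_weight_dispersion_le {d : ℕ} (hd : 2 ≤ d) (u : ℝ) {s : ℝ} (hs : 0 < s) (hs1 : s ≤ 1)
    (hL : 6 ≤ L * s) :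
    ((L : ℝ) ^ d)⁻¹ * ∑ k : Torus d L, weight u s (dispersion L k) ≤
      4 * sinAvgBound (s / 6) ^ 2 := by
  obtain ⟨m, rfl⟩ := Nat.exists_eq_add_of_le' hd
  have hL0 : (0 : ℝ) < L := by exact_mod_cast Nat.pos_of_ne_zero (NeZero.ne L)
  rw [sum_dispersion_succ, sum_dispersion_succ L fun e =>
    ∑ a : ZMod L, weight u s (2 * cosMode L a + e)]
  have key : ∀ k : Torus m L, ∑ a : ZMod L, ∑ b : ZMod L,
      weight u s (2 * cosMode L b + (2 * cosMode L a + dispersion L k)) ≤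
        (L : ℝ) ^ 2 * (4 * sinAvgBound (s / 6) ^ 2) := by
    intro k
    have h := zmodAvg_zmodAvg_inv_cosMode_le (L := L) (r := s / 6) (by positivity) (by linarith)
      (by linarith) ((u - dispersion L k) / 2)
    have e : ∀ a b : ZMod L, weight u s (2 * cosMode L b + (2 * cosMode L a + dispersion L k)) =
        1 / 2 * (|cosMode L b + cosMode L a - (u - dispersion L k) / 2| + 3 * (s / 6))⁻¹ := by
      intro a b
      rw [weight, one_div, ← mul_inv, mul_add]
      congr 2
      · rw [show 2 * cosMode L b + (2 * cosMode L a + dispersion L k) - u =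
          2 * (cosMode L b + cosMode L a - (u - dispersion L k) / 2) by ring, abs_mul, abs_two]
      · ring
    have e2 : ∀ F : ZMod L → ZMod L → ℝ, ∑ a, ∑ b, 1 / 2 * F a b =
        (L : ℝ) ^ 2 * (1 / 2 * zmodAvg L (fun a => zmodAvg L fun b => F a b)) := by
      intro F
      simp only [zmodAvg, ← Finset.mul_sum]
      field_simp
    simp only [e]
    rw [e2]
    exact mul_le_mul_of_nonneg_left (by linarith) (by positivity)
  calc _ ≤ ((L : ℝ) ^ (m + 2))⁻¹ * ∑ _k : Torus m L, (L : ℝ) ^ 2 * (4 * sinAvgBound (s / 6) ^ 2) := by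
        gcongr with k
        exact key k
    _ = _ := by
        rw [Finset.sum_const, Finset.card_univ, nsmul_eq_mul, Fintype.card_fun, ZMod.card,
          Fintype.card_fin]
        push_cast
        rw [pow_add]
        field_simp

end Density

/-! ### Fourier diagonalization of the Laplacian -/

section Fourier

open scoped Matrix.Norms.L2Operator

variable (d L : ℕ) [NeZero L]

/-- The unitary matrix of the discrete Fourier transform on the torus. -/
noncomputable def fourierMatrix : Matrix (Torus d L) (Torus d L) ℂ :=
  Matrix.of fun x k => ((Real.sqrt ((L : ℝ) ^ d))⁻¹ : ℂ) * ZMod.stdAddChar (k ⬝ᵥ x)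

variable {d L}

theorem sum_stdAddChar_dotProduct (z : Torus d L) :
    ∑ k : Torus d L, (ZMod.stdAddChar (k ⬝ᵥ z) : ℂ) = if z = 0 then (L : ℂ) ^ d else 0 := by
  let ψ : AddChar (Torus d L) ℂ :=
    { toFun := fun k => ZMod.stdAddChar (k ⬝ᵥ z)
      map_zero_eq_one' := by simp
      map_add_eq_mul' := fun a b => by rw [add_dotProduct, AddChar.map_add_eq_mul] }
  have h : ψ = 0 ↔ z = 0 := by
    constructor
    · intro h
      ext i
      have h1 : ψ (Pi.single i 1) = 1 := by rw [h]; rfl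
      have h2 : ZMod.stdAddChar (z i) = (1 : ℂ) := by
        have : ψ (Pi.single i 1) = ZMod.stdAddChar (Pi.single i 1 ⬝ᵥ z) := rfl
        rwa [this, single_dotProduct, one_mul] at h1
      rw [← AddChar.map_zero_eq_one (ZMod.stdAddChar : AddChar (ZMod L) ℂ)] at h2
      exact ZMod.injective_stdAddChar h2
    · rintro rfl
      ext k
      change ZMod.stdAddChar (k ⬝ᵥ 0) = (1 : ℂ)
      simp
  classical
  have := AddChar.sum_eq_ite ψ
  simp only [h] at this
  refine Eq.trans ?_ (this.trans ?_)
  · rfl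
  · simp [ZMod.card]

theorem star_stdAddChar (a : ZMod L) :
    star (ZMod.stdAddChar a : ℂ) = ZMod.stdAddChar (-a) := by
  rw [AddChar.map_neg_eq_inv, ZMod.stdAddChar_apply, Complex.star_def,
    ← Circle.coe_inv_eq_conj, Circle.coe_inv]

omit [NeZero L] in
theorem fourierMatrix_normalization : ((Real.sqrt ((L : ℝ) ^ d))⁻¹ : ℂ) *
    ((Real.sqrt ((L : ℝ) ^ d))⁻¹ : ℂ) = ((L : ℂ) ^ d)⁻¹ := by
  rw [← mul_inv, ← Complex.ofReal_mul, Real.mul_self_sqrt (by positivity)]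
  push_cast
  rfl

theorem fourierMatrix_mul_star : fourierMatrix d L * star (fourierMatrix d L) = 1 := by
  have hL0 : (L : ℂ) ^ d ≠ 0 := pow_ne_zero _ (by exact_mod_cast NeZero.ne L)
  ext x y
  rw [Matrix.mul_apply]
  have : ∀ k, fourierMatrix d L x k * star (fourierMatrix d L) k y =
      ((L : ℂ) ^ d)⁻¹ * ZMod.stdAddChar (k ⬝ᵥ (x - y)) := by
    intro k
    rw [Matrix.star_apply, fourierMatrix, Matrix.of_apply, Matrix.of_apply, star_mul',
      star_stdAddChar, dotProduct_sub, sub_eq_add_neg, AddChar.map_add_eq_mul,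
      ← fourierMatrix_normalization]
    simp only [Complex.star_def, map_inv₀, Complex.conj_ofReal]
    ring
  simp only [this, ← Finset.mul_sum, sum_stdAddChar_dotProduct, sub_eq_zero, Matrix.one_apply]
  split_ifs
  · exact inv_mul_cancel₀ hL0
  · exact mul_zero _

theorem stdAddChar_add_neg (a : ZMod L) :
    (ZMod.stdAddChar a : ℂ) + ZMod.stdAddChar (-a) = ((2 * cosMode L a : ℝ) : ℂ) := by
  rw [← star_stdAddChar, Complex.star_def, Complex.add_conj, cosMode, ZMod.stdAddChar_apply,
    ZMod.toCircle_apply]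
  congr 2
  have : (2 * Real.pi * Complex.I * (a.val : ℂ) / (L : ℂ)) =
      ((2 * (Real.pi * a.val / L) : ℝ) : ℂ) * Complex.I := by push_cast; ring
  rw [this, Complex.exp_ofReal_mul_I_re]

theorem laplacian_mul_fourierMatrix : laplacian d L * fourierMatrix d L =
    fourierMatrix d L * Matrix.diagonal fun k => (dispersion L k : ℂ) := by
  ext x k
  rw [Matrix.mul_diagonal]
  have h := laplacian_mulVec d L (fun x => fourierMatrix d L x k) x
  have h2 : (laplacian d L * fourierMatrix d L) x k =
      (laplacian d L).mulVec (fun x => fourierMatrix d L x k) x := rfl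
  rw [h2, h, dispersion, Complex.ofReal_sum, Finset.mul_sum]
  refine Finset.sum_congr rfl fun i _ => ?_
  rw [← stdAddChar_add_neg]
  simp only [fourierMatrix, Matrix.of_apply, dotProduct_add, sub_eq_add_neg, dotProduct_neg,
    dotProduct_single, mul_one, AddChar.map_add_eq_mul]
  ring

theorem laplacian_eq_conj : laplacian d L = fourierMatrix d L *
    Matrix.diagonal (fun k => (dispersion L k : ℂ)) * star (fourierMatrix d L) := by
  rw [← laplacian_mul_fourierMatrix, Matrix.mul_assoc, fourierMatrix_mul_star, Matrix.mul_one]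

theorem applyFun_laplacian (f : ℝ → ℂ) : applyFun (laplacian_isHermitian d L) f =
    fourierMatrix d L * Matrix.diagonal (fun k => f (dispersion L k)) *
      star (fourierMatrix d L) :=
  applyFun_eq_of_diagonalization _ fourierMatrix_mul_star _ laplacian_eq_conj f

theorem applyFun_laplacian_apply_self (f : ℝ → ℂ) (x : Torus d L) :
    applyFun (laplacian_isHermitian d L) f x x =
      ((L : ℂ) ^ d)⁻¹ * ∑ k : Torus d L, f (dispersion L k) := by
  rw [applyFun_laplacian, Matrix.mul_apply, Finset.mul_sum]
  refine Finset.sum_congr rfl fun k _ => ?_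
  rw [Matrix.mul_diagonal, Matrix.star_apply, fourierMatrix, Matrix.of_apply, star_mul',
    star_stdAddChar, ← fourierMatrix_normalization]
  simp only [Complex.star_def, map_inv₀, Complex.conj_ofReal]
  have : (ZMod.stdAddChar (k ⬝ᵥ x) : ℂ) * ZMod.stdAddChar (-(k ⬝ᵥ x)) = 1 := by
    rw [← AddChar.map_add_eq_mul, add_neg_cancel, AddChar.map_zero_eq_one]
  linear_combination ((Real.sqrt ((L : ℝ) ^ d))⁻¹ : ℂ) * ((Real.sqrt ((L : ℝ) ^ d))⁻¹ : ℂ) *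
    f (dispersion L k) * this

theorem abs_eigenvalues_laplacian_le (j : Torus d L) :
    |(laplacian_isHermitian d L).eigenvalues j| ≤ 2 * d := by
  have h1 : ‖laplacian d L‖ ≤ 2 * d := by
    rw [laplacian_eq_conj, norm_conj_unitary fourierMatrix_mul_star, Matrix.l2_opNorm_diagonal]
    refine (pi_norm_le_iff_of_nonneg (by positivity)).2 fun k => ?_
    rw [Complex.norm_real]
    exact abs_dispersion_le L k
  have h2 : ‖laplacian d L‖ =
      ‖fun j => (((laplacian_isHermitian d L).eigenvalues j : ℝ) : ℂ)‖ := by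
    calc ‖laplacian d L‖ = ‖applyFun (laplacian_isHermitian d L) fun x => (x : ℂ)‖ := by
          rw [applyFun_ofReal]
      _ = _ := by
          rw [applyFun, norm_conj_unitary (eigenvectorUnitary_mul_star (laplacian_isHermitian d L)),
            Matrix.l2_opNorm_diagonal]
  rw [h2] at h1
  have := (pi_norm_le_iff_of_nonneg (by positivity)).1 h1 j
  rwa [Complex.norm_real] at this

end Fourier


/-! ### The sandwiched potential -/

section Sandwich

open scoped Matrix.Norms.L2Operator

variable {d L : ℕ} [NeZero L]

/-- The potential between two factors `w_{u,s}(Δ)^{1/2}`. -/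
noncomputable def sandwich (u s : ℝ) (V : Torus d L → ℝ) : Matrix (Torus d L) (Torus d L) ℂ :=
  sqrtWeight (laplacian_isHermitian d L) u s * Matrix.diagonal (fun x => (V x : ℂ)) *
    sqrtWeight (laplacian_isHermitian d L) u s

theorem norm_sandwich_le {u s : ℝ} (hs : 0 < s) {V : Torus d L → ℝ} {ε : ℝ} (hε : 0 ≤ ε)
    (hV : ∀ x, |V x| ≤ ε) : ‖sandwich u s V‖ ≤ ε / s := by
  have hG := norm_sqrtWeight_le (laplacian_isHermitian d L) (u := u) hs
  have hD : ‖Matrix.diagonal (fun x => (V x : ℂ))‖ ≤ ε := by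
    rw [Matrix.l2_opNorm_diagonal]
    refine (pi_norm_le_iff_of_nonneg hε).2 fun x => ?_
    rw [Complex.norm_real]
    exact hV x
  calc ‖sandwich u s V‖ ≤ Real.sqrt s⁻¹ * ε * Real.sqrt s⁻¹ := by
        refine (norm_mul_le _ _).trans ?_
        gcongr
        refine (norm_mul_le _ _).trans ?_
        gcongr
    _ = ε / s := by
        rw [mul_right_comm, Real.mul_self_sqrt (inv_nonneg.2 hs.le), div_eq_mul_inv, mul_comm]

theorem norm_hamiltonian_sub_laplacian_le {lam : ℝ} (hlam : 0 < lam) (V : Torus d L → ℝ) (u : ℝ)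
    {s : ℝ} (hs : 0 < s) :
    ‖applyFun (hamiltonian_isHermitian d L lam V) (fun x => (lorentz u s x : ℂ)) -
        applyFun (laplacian_isHermitian d L) (fun x => (lorentz u s x : ℂ))‖ ≤
      8 * lam * ‖sandwich u s V‖ := by
  have h := norm_sub_applyFun_lorentz_le (laplacian_isHermitian d L)
    (hamiltonian_isHermitian d L lam V) (u := u) (W := (lam : ℂ) • Matrix.diagonal fun x => (V x : ℂ))
    rfl hs
  rw [Matrix.mul_smul, Matrix.smul_mul, norm_smul, Complex.norm_real,
    Real.norm_of_nonneg hlam.le, ← mul_assoc] at h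
  exact h

theorem norm_hamiltonian_sub_laplacian_le_two (lam : ℝ) (V : Torus d L → ℝ) (u s : ℝ) :
    ‖applyFun (hamiltonian_isHermitian d L lam V) (fun x => (lorentz u s x : ℂ)) -
        applyFun (laplacian_isHermitian d L) (fun x => (lorentz u s x : ℂ))‖ ≤ 2 := by
  refine (norm_sub_le _ _).trans ?_
  linarith [norm_applyFun_lorentz_le (hamiltonian_isHermitian d L lam V) u s,
    norm_applyFun_lorentz_le (laplacian_isHermitian d L) u s]

/-- The coefficient matrices of the sandwiched potential. -/
noncomputable def sandwichCoeff (u s : ℝ) (x : Torus d L) : Matrix (Torus d L) (Torus d L) ℂ :=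
  sqrtWeight (laplacian_isHermitian d L) u s * Matrix.single x x 1 *
    sqrtWeight (laplacian_isHermitian d L) u s

theorem sandwich_eq_matrixSeries (u s : ℝ) (V : Torus d L → ℝ) :
    sandwich u s V = matrixSeries (sandwichCoeff u s) V := by
  rw [sandwich, matrixSeries, ← Matrix.sum_single_eq_diagonal, Matrix.mul_sum, Matrix.sum_mul]
  refine Finset.sum_congr rfl fun x _ => ?_
  rw [sandwichCoeff, ← Matrix.smul_mul, ← Matrix.mul_smul, Matrix.smul_single, smul_eq_mul, mul_one]

theorem sandwichCoeff_isHermitian (u s : ℝ) (x : Torus d L) :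
    (sandwichCoeff u s x).IsHermitian := by
  have hG := star_sqrtWeight (laplacian_isHermitian d L) u s
  rw [Matrix.star_eq_conjTranspose] at hG
  rw [Matrix.IsHermitian, sandwichCoeff, Matrix.conjTranspose_mul, Matrix.conjTranspose_mul, hG,
    Matrix.conjTranspose_single, star_one, Matrix.mul_assoc]

/-- The matrix variance of the sandwiched potential: with `G = w(Δ)^{1/2}` it is
`G diag((G²)_{xx}) G`, and translation invariance makes `(G²)_{xx}` a density of states. -/
theorem norm_sum_sandwichCoeff_mul_self_le (hd : 2 ≤ d) (u : ℝ) {s : ℝ} (hs : 0 < s) (hs1 : s ≤ 1)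
    (hL : 6 ≤ L * s) :
    ‖∑ x, sandwichCoeff (d := d) (L := L) u s x * sandwichCoeff u s x‖ ≤
      4 * sinAvgBound (s / 6) ^ 2 / s := by
  set G := sqrtWeight (laplacian_isHermitian d L) u s with hG
  set ρ := 4 * sinAvgBound (s / 6) ^ 2 with hρ
  have hρ0 : 0 ≤ ρ := by positivity
  have hsingle : ∀ x, sandwichCoeff u s x * sandwichCoeff u s x =
      G * Matrix.single x x ((G * G) x x) * G := by
    intro x
    have h : Matrix.single x x (1 : ℂ) * (G * G) * Matrix.single x x 1 =
        Matrix.single x x ((G * G) x x) := by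
      rw [Matrix.single_mul_mul_single]; simp
    rw [← h, sandwichCoeff, ← hG]
    simp only [Matrix.mul_assoc]
  have hdiag : ∀ x, ‖(G * G) x x‖ ≤ ρ := by
    intro x
    rw [hG, sqrtWeight_mul_self _ hs, applyFun_laplacian_apply_self]
    have e : ((L : ℂ) ^ d)⁻¹ * ∑ k : Torus d L, (weight u s (dispersion L k) : ℂ) =
        ((((L : ℝ) ^ d)⁻¹ * ∑ k : Torus d L, weight u s (dispersion L k) : ℝ) : ℂ) := by
      push_cast; rfl
    rw [e, Complex.norm_real, Real.norm_of_nonneg]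
    · exact avg_weight_dispersion_le L hd u hs hs1 hL
    · exact mul_nonneg (by positivity) (Finset.sum_nonneg fun k _ => (weight_pos hs _).le)
  simp only [hsingle]
  rw [← Matrix.sum_mul, ← Matrix.mul_sum, Matrix.sum_single_eq_diagonal (fun x => (G * G) x x)]
  have hGn : ‖G‖ ≤ Real.sqrt s⁻¹ := norm_sqrtWeight_le _ hs
  have hD : ‖Matrix.diagonal (fun x => (G * G) x x)‖ ≤ ρ := by
    rw [Matrix.l2_opNorm_diagonal]
    exact (pi_norm_le_iff_of_nonneg hρ0).2 hdiag
  calc _ ≤ Real.sqrt s⁻¹ * ρ * Real.sqrt s⁻¹ := by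
        refine (norm_mul_le _ _).trans ?_
        gcongr
        refine (norm_mul_le _ _).trans ?_
        gcongr
    _ = ρ / s := by
        rw [mul_right_comm, Real.mul_self_sqrt (inv_nonneg.2 hs.le), div_eq_mul_inv, mul_comm]

theorem measureReal_norm_sandwich_ge_le (hd : 2 ≤ d) (u : ℝ) {s : ℝ} (hs : 0 < s) (hs1 : s ≤ 1)
    (hL : 6 ≤ L * s) {T : ℝ} (hT : 0 < T) {p : ℕ} (hp : p ≠ 0) :
    (potentialLaw d L).real {V | T * s ^ (-(1 / 2) : ℝ) ≤ ‖sandwich u s V‖} ≤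
      (L : ℝ) ^ d * (16 * p * sinAvgBound (s / 6) ^ 2 / T ^ 2) ^ p := by
  have hsp : 0 < s ^ (-(1 / 2) : ℝ) := Real.rpow_pos_of_pos hs _
  have h := measureReal_norm_matrixSeries_ge_le
    (sandwichCoeff_isHermitian (d := d) (L := L) u s)
    (norm_sum_sandwichCoeff_mul_self_le hd u hs hs1 hL)
    (mul_pos hT hsp) hp
  simp only [← sandwich_eq_matrixSeries] at h
  refine h.trans_eq ?_
  have hsq : (s ^ (-(1 / 2) : ℝ)) ^ 2 = s⁻¹ := by
    rw [← Real.rpow_natCast, ← Real.rpow_mul hs.le, ← Real.rpow_neg_one]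
    norm_num
  rw [mul_pow, hsq, Fintype.card_fun, ZMod.card, Fintype.card_fin]
  push_cast
  congr 2
  field_simp
  ring

/-! ### Reduction to finitely many energies and widths -/

/-- The bound at the points of a grid of mesh `η` implies it at all energies and all widths `≥ η`,
up to a constant. Energies are first clamped to `[-2d, 2d]` and widths to `(0, 1]`. -/
theorem norm_sandwich_le_of_grid {η T : ℝ} (hη : 0 < η) (hη1 : η ≤ 1) (hT : 0 ≤ T)
    {V : Torus d L → ℝ} {n m : ℕ} (hn : (2 * d + 1) / η ≤ n) (hm : m = ⌊1 / η⌋₊)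
    (h : ∀ i ∈ Finset.Icc (-(n : ℤ)) n, ∀ j ∈ Finset.Icc 1 m,
      ‖sandwich (η * i) (η * j) V‖ ≤ T * (η * j) ^ (-(1 / 2) : ℝ))
    (u : ℝ) {s : ℝ} (hs : η ≤ s) :
    ‖sandwich u s V‖ ≤ 8 * (d + 1) * T * s ^ (-(1 / 2) : ℝ) := by
  have hs0 : 0 < s := hη.trans_le hs
  have hd0 : (0 : ℝ) ≤ d := Nat.cast_nonneg d
  set uc := max (-(2 * d : ℝ)) (min u (2 * d)) with huc
  set sc := min s 1 with hsc
  have huc1 : -(2 * d : ℝ) ≤ uc := le_max_left _ _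
  have huc2 : uc ≤ 2 * d := max_le (by linarith) (min_le_right _ _)
  have hscη : η ≤ sc := le_min hs hη1
  set i : ℤ := ⌊uc / η⌋ with hi
  set j : ℕ := ⌊sc / η⌋₊ with hj
  have hj1 : 1 ≤ j := Nat.le_floor (by rw [Nat.cast_one]; exact (one_le_div₀ hη).2 hscη)
  have hjm : j ≤ m := by
    rw [hm]
    exact Nat.floor_le_floor (by gcongr; exact min_le_right _ _)
  have hi1 : η * i ≤ uc := by
    have := Int.floor_le (uc / η)
    rwa [le_div_iff₀ hη, mul_comm] at this
  have hi2 : uc < η * i + η := by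
    have := Int.lt_floor_add_one (uc / η)
    rw [div_lt_iff₀ hη] at this
    linarith
  have hj2 : η * j ≤ sc := by
    have := Nat.floor_le (a := sc / η) (by positivity)
    rwa [le_div_iff₀ hη, mul_comm] at this
  have hj3 : sc < η * j + η := by
    have := Nat.lt_floor_add_one (sc / η)
    rw [div_lt_iff₀ hη] at this
    linarith
  have hj1' : (1 : ℝ) ≤ j := by exact_mod_cast hj1
  have hηj : η ≤ η * j := by nlinarith
  have hin : i ∈ Finset.Icc (-(n : ℤ)) n := by
    rw [div_le_iff₀ hη] at hn
    rw [Finset.mem_Icc]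
    constructor
    · have : -(n : ℝ) ≤ i := by
        by_contra hcon
        push Not at hcon
        nlinarith
      exact_mod_cast this
    · have : (i : ℝ) ≤ n := by
        by_contra hcon
        push Not at hcon
        nlinarith
      exact_mod_cast this
  have hgrid := h i hin j (Finset.mem_Icc.2 ⟨hj1, hjm⟩)
  set u' := η * (i : ℝ)
  set s' := η * (j : ℝ)
  have hs' : 0 < s' := hη.trans_le hηj
  have hκ : 0 ≤ 8 * (d + 1) * (s' / s) := by positivity
  have hw : ∀ k, weight u s ((laplacian_isHermitian d L).eigenvalues k) ≤
      8 * (d + 1) * (s' / s) * weight u' s' ((laplacian_isHermitian d L).eigenvalues k) := by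
    intro k
    have he := abs_le.1 (abs_eigenvalues_laplacian_le (d := d) (L := L) k)
    set e := (laplacian_isHermitian d L).eigenvalues k
    have h1 : |e - uc| ≤ |e - u| := by
      rcases le_total u (2 * d) with hu | hu
      · rcases le_total (-(2 * d : ℝ)) u with hu' | hu'
        · rw [huc, min_eq_left hu, max_eq_right hu']
        · rw [huc, min_eq_left hu, max_eq_left hu', abs_of_nonneg (by linarith),
            abs_of_nonneg (by linarith)]
          linarith
      · rw [huc, min_eq_right hu, max_eq_right (by linarith), abs_of_nonpos (by linarith),
          abs_of_nonpos (by linarith)]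
        linarith
    have h2 : |e - u'| ≤ |e - uc| + η := by
      have := abs_sub_le e uc u'
      rw [abs_of_nonneg (by linarith : 0 ≤ uc - u')] at this
      linarith
    have h3 : |e - uc| ≤ 4 * d := abs_le.2 ⟨by linarith, by linarith⟩
    have hu0 := abs_nonneg (e - u)
    have key : (|e - u'| + s') * s ≤ 8 * (d + 1) * s' * (|e - u| + s) := by
      rcases le_total s 1 with hs1 | hs1
      · rw [hsc, min_eq_left hs1] at hj2 hj3
        have a1 : |e - u'| + s' ≤ 2 * (|e - u| + s) := by linarith
        have a2 : s ≤ 2 * s' := by linarith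
        calc (|e - u'| + s') * s ≤ (2 * (|e - u| + s)) * (2 * s') := by gcongr
          _ = 4 * s' * (|e - u| + s) := by ring
          _ ≤ 8 * (d + 1) * s' * (|e - u| + s) := by
              gcongr
              linarith
      · rw [hsc, min_eq_right hs1] at hj2 hj3
        have a1 : |e - u'| + s' ≤ 4 * d + 2 := by linarith
        have a2 : 1 ≤ 2 * s' := by linarith
        calc (|e - u'| + s') * s ≤ (4 * d + 2) * s := by gcongr
          _ ≤ (4 * (d + 1) * (2 * s')) * (|e - u| + s) := by
              gcongr
              · nlinarith
              · linarith
          _ = _ := by ring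
    rw [weight, weight, ← div_eq_mul_inv, inv_eq_one_div, div_le_div_iff₀ (by positivity)
      (by positivity), one_mul]
    calc |e - u'| + s' ≤ 8 * (d + 1) * s' * (|e - u| + s) / s := by
          rwa [le_div_iff₀ hs0]
      _ = _ := by ring
  have hcmp := norm_sandwich_le_of_weight_le (laplacian_isHermitian d L)
    (Matrix.diagonal fun x => (V x : ℂ)) hs' hw hs0 hκ
  have hs's : s' ≤ s := hj2.trans (min_le_left _ _)
  calc ‖sandwich u s V‖ ≤ 8 * (d + 1) * (s' / s) * ‖sandwich u' s' V‖ := hcmp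
    _ ≤ 8 * (d + 1) * (s' / s) * (T * s' ^ (-(1 / 2) : ℝ)) := by gcongr
    _ = 8 * (d + 1) * T * (s' ^ (1 / 2 : ℝ) / s) := by
        have : s' * s' ^ (-(1 / 2) : ℝ) = s' ^ (1 / 2 : ℝ) := by
          nth_rewrite 1 [← Real.rpow_one s']
          rw [← Real.rpow_add hs']
          norm_num
        rw [← this]; ring
    _ ≤ 8 * (d + 1) * T * (s ^ (1 / 2 : ℝ) / s) := by gcongr
    _ = 8 * (d + 1) * T * s ^ (-(1 / 2) : ℝ) := by
        congr 1
        nth_rewrite 2 [← Real.rpow_one s]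
        rw [← Real.rpow_sub hs0]
        norm_num

/-- For widths below `lam²` the difference of the Lorentzians is bounded trivially. -/
theorem norm_hamiltonian_sub_laplacian_le_of_sandwich {lam T : ℝ} (hlam : 0 < lam) (hT : 1 ≤ T)
    {V : Torus d L → ℝ}
    (h : ∀ u s : ℝ, lam ^ 2 ≤ s → ‖sandwich u s V‖ ≤ 8 * (d + 1) * T * s ^ (-(1 / 2) : ℝ))
    (u : ℝ) {s : ℝ} (hs : 0 < s) :
    ‖applyFun (hamiltonian_isHermitian d L lam V) (fun x => (lorentz u s x : ℂ)) -
        applyFun (laplacian_isHermitian d L) (fun x => (lorentz u s x : ℂ))‖ ≤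
      64 * (d + 1) * T * lam * s ^ (-(1 / 2) : ℝ) := by
  rcases le_or_gt (lam ^ 2) s with hls | hls
  · calc _ ≤ 8 * lam * ‖sandwich u s V‖ := norm_hamiltonian_sub_laplacian_le hlam V u hs
      _ ≤ 8 * lam * (8 * (d + 1) * T * s ^ (-(1 / 2) : ℝ)) := by
          gcongr
          exact h u s hls
      _ = _ := by ring
  · refine (norm_hamiltonian_sub_laplacian_le_two lam V u s).trans ?_
    have h1 : 1 ≤ lam * s ^ (-(1 / 2) : ℝ) := by
      rw [Real.rpow_neg hs.le, ← Real.sqrt_eq_rpow, ← div_eq_mul_inv,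
        one_le_div₀ (Real.sqrt_pos.2 hs)]
      exact Real.sqrt_le_iff.2 ⟨hlam.le, hls.le⟩
    have h2 : 1 ≤ T * (lam * s ^ (-(1 / 2) : ℝ)) := one_le_mul_of_one_le_of_one_le hT h1
    have hd0 : (0 : ℝ) ≤ d := Nat.cast_nonneg d
    nlinarith

theorem sinAvgBound_div_six_le {lam s : ℝ} (hlam : 0 < lam) (hs : lam ^ 2 ≤ s) (hs1 : s ≤ 1)
    (hl : 1 ≤ Real.log lam⁻¹) : sinAvgBound (s / 6) ≤ 20 * Real.log lam⁻¹ := by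
  have hs0 : 0 < s := (pow_pos hlam 2).trans_le hs
  have h1 : (1 + s / 6) / (s / 6) ≤ Real.exp 2 * lam⁻¹ ^ 2 := by
    have h2 : s⁻¹ ≤ lam⁻¹ ^ 2 := by rw [inv_pow]; gcongr
    have h3 : (7 : ℝ) ≤ Real.exp 2 := by
      have := Real.exp_one_gt_d9
      have e : Real.exp 2 = Real.exp 1 * Real.exp 1 := by rw [← Real.exp_add]; norm_num
      rw [e]; nlinarith
    calc (1 + s / 6) / (s / 6) = (6 + s) * s⁻¹ := by field_simp
      _ ≤ 7 * s⁻¹ := by gcongr; linarith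
      _ ≤ Real.exp 2 * lam⁻¹ ^ 2 := by gcongr
  have h4 : Real.log ((1 + s / 6) / (s / 6)) ≤ 2 + 2 * Real.log lam⁻¹ := by
    refine (Real.log_le_log (by positivity) h1).trans_eq ?_
    rw [Real.log_mul (Real.exp_ne_zero _) (by positivity), Real.log_exp, Real.log_pow]
    norm_num
  have h5 : 0 ≤ Real.log ((1 + s / 6) / (s / 6)) :=
    Real.log_nonneg ((one_le_div₀ (by positivity)).2 (by linarith))
  rw [sinAvgBound]
  have hπ := Real.pi_lt_four
  calc (Real.pi + 1) * Real.log ((1 + s / 6) / (s / 6)) ≤ 5 * (2 + 2 * Real.log lam⁻¹) := by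
        gcongr
        linarith
    _ ≤ 20 * Real.log lam⁻¹ := by linarith

/-- The constant in the bound for the sandwiched potential; it is large enough for the tail
probability at a single grid point to beat the dimension and the number of grid points. -/
noncomputable def tailConst (d : ℕ) : ℝ := 120 * Real.exp ((101 * d + 6) / 2)

theorem one_le_tailConst (d : ℕ) : 1 ≤ tailConst d := by
  have : 1 ≤ Real.exp ((101 * (d : ℝ) + 6) / 2) := Real.one_le_exp (by positivity)
  unfold tailConst
  linarith

omit [NeZero L] in
theorem six_le_mul_sq {lam : ℝ} (hlam : 0 < lam) (hl : 1 ≤ Real.log lam⁻¹)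
    (hL : |(L : ℝ) - lam ^ (-100 : ℤ)| < 1) : 6 ≤ L * lam ^ 2 := by
  have hx : 2 ≤ lam⁻¹ := by
    have := Real.exp_one_gt_d9
    have h := (Real.le_log_iff_exp_le (by positivity)).1 hl
    linarith
  have h1 := (abs_lt.1 hL).1
  have h2 : lam ^ (-100 : ℤ) = lam⁻¹ ^ 98 * lam⁻¹ ^ 2 := by
    rw [← pow_add, inv_pow, zpow_neg]; rfl
  have h3 : (2 : ℝ) ^ 98 ≤ lam⁻¹ ^ 98 := by gcongr
  have h4 : (7 : ℝ) ≤ lam⁻¹ ^ 98 := le_trans (by norm_num) h3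
  have h5 : 7 * lam⁻¹ ^ 2 ≤ lam ^ (-100 : ℤ) := by
    rw [h2]; gcongr
  have h6 : lam⁻¹ ^ 2 * lam ^ 2 = 1 := by rw [← mul_pow, inv_mul_cancel₀ hlam.ne', one_pow]
  have h7 : (1 : ℝ) ≤ lam⁻¹ ^ 2 := one_le_pow₀ (by linarith)
  have h8 : 6 * lam⁻¹ ^ 2 ≤ L := by linarith
  calc (6 : ℝ) = 6 * lam⁻¹ ^ 2 * lam ^ 2 := by rw [mul_assoc, h6, mul_one]
    _ ≤ L * lam ^ 2 := by gcongr

omit [NeZero L] in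
theorem cast_le_exp {lam : ℝ} (hlam : 0 < lam) (hl : 1 ≤ Real.log lam⁻¹)
    (hL : |(L : ℝ) - lam ^ (-100 : ℤ)| < 1) : (L : ℝ) ≤ Real.exp (101 * Real.log lam⁻¹) := by
  have hx : 2 ≤ lam⁻¹ := by
    have := Real.exp_one_gt_d9
    have h := (Real.le_log_iff_exp_le (by positivity)).1 hl
    linarith
  have h1 := (abs_lt.1 hL).2
  have h2 : lam ^ (-100 : ℤ) = lam⁻¹ ^ 100 := by
    rw [inv_pow, zpow_neg]; rfl
  have h3 : Real.exp (101 * Real.log lam⁻¹) = lam⁻¹ ^ 101 := by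
    rw [mul_comm, Real.exp_mul, Real.exp_log (by positivity)]
    exact_mod_cast Real.rpow_natCast lam⁻¹ 101
  have h4 : (1 : ℝ) ≤ lam⁻¹ ^ 100 := one_le_pow₀ (by linarith)
  rw [h3, pow_succ]
  rw [h2] at h1
  nlinarith

/-- With overwhelming probability the Lorentzians of `H` and `Δ` differ by
`O(log^{3/2} · lam · s^{-1/2})`, for all energies and widths at once. -/
theorem measureReal_lorentz_bound_ge (hd : 2 ≤ d) {lam : ℝ} (hlam : 0 < lam)
    (hl : 1 ≤ Real.log lam⁻¹) (hld : (4 * d + 5 : ℝ) ≤ lam⁻¹)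
    (hL : |(L : ℝ) - lam ^ (-100 : ℤ)| < 1) {K : ℝ} (hK : 1 ≤ K) :
    1 - Real.exp (-(K ^ 2 * Real.log lam⁻¹)) ≤ (potentialLaw d L).real
      {V | ∀ u s : ℝ, 0 < s →
        ‖applyFun (hamiltonian_isHermitian d L lam V) (fun x => (lorentz u s x : ℂ)) -
          applyFun (laplacian_isHermitian d L) (fun x => (lorentz u s x : ℂ))‖ ≤
        64 * (d + 1) * (tailConst d * K * (Real.log lam⁻¹ * Real.sqrt (Real.log lam⁻¹))) * lam *
          s ^ (-(1 / 2) : ℝ)} := by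
  set l := Real.log lam⁻¹ with hldef
  set T := tailConst d * K * (l * Real.sqrt l) with hT
  set η := lam ^ 2 with hηdef
  have hη : 0 < η := by positivity
  have hx1 : 1 ≤ lam⁻¹ := by
    have : (0 : ℝ) ≤ d := Nat.cast_nonneg d
    linarith
  have hη1 : η ≤ 1 := by
    have : lam ≤ 1 := by rwa [one_le_inv₀ hlam] at hx1
    exact pow_le_one₀ hlam.le this
  have hsl : 1 ≤ Real.sqrt l := Real.one_le_sqrt.2 hl
  have hT1 : 1 ≤ T := by
    rw [hT]
    exact one_le_mul_of_one_le_of_one_le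
      (one_le_mul_of_one_le_of_one_le (one_le_tailConst d) hK)
      (one_le_mul_of_one_le_of_one_le hl hsl)
  have hT0 : 0 < T := by linarith
  set n := ⌈(2 * d + 1) / η⌉₊ with hn
  set m := ⌊1 / η⌋₊ with hm
  set p := ⌈K ^ 2 * l⌉₊ with hp
  have hKl : 1 ≤ K ^ 2 * l := one_le_mul_of_one_le_of_one_le (one_le_pow₀ hK) hl
  have hp0 : p ≠ 0 := (Nat.ceil_pos.2 (by linarith)).ne'
  have hp1 : K ^ 2 * l ≤ p := Nat.le_ceil _
  have hp2 : (p : ℝ) ≤ 2 * (K ^ 2 * l) := by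
    have := Nat.ceil_lt_add_one (a := K ^ 2 * l) (by linarith)
    linarith
  set bad : ℤ × ℕ → Set (Torus d L → ℝ) := fun q =>
    {V | T * (η * q.2) ^ (-(1 / 2) : ℝ) ≤ ‖sandwich (η * q.1) (η * q.2) V‖} with hbad
  set net := Finset.Icc (-(n : ℤ)) n ×ˢ Finset.Icc 1 m with hnet
  set good : Set (Torus d L → ℝ) := {V | ∀ u s : ℝ, 0 < s →
        ‖applyFun (hamiltonian_isHermitian d L lam V) (fun x => (lorentz u s x : ℂ)) -
          applyFun (laplacian_isHermitian d L) (fun x => (lorentz u s x : ℂ))‖ ≤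
        64 * (d + 1) * T * lam * s ^ (-(1 / 2) : ℝ)} with hgood
  have hcover : Set.univ ⊆ good ∪ ⋃ q ∈ net, bad q := by
    intro V _
    by_cases hV : V ∈ ⋃ q ∈ net, bad q
    · exact Or.inr hV
    · left
      simp only [Set.mem_iUnion, not_exists, hbad, Set.mem_ofPred_eq, not_le] at hV
      intro u s hs
      refine norm_hamiltonian_sub_laplacian_le_of_sandwich hlam hT1 (fun u s hs => ?_) u hs
      refine norm_sandwich_le_of_grid hη hη1 hT0.le (Nat.le_ceil _) hm (fun i hi j hj => ?_) u hs
      exact (hV (i, j) (Finset.mem_product.2 ⟨hi, hj⟩)).le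
  -- one grid point
  have hone : ∀ q ∈ net, (potentialLaw d L).real (bad q) ≤
      (L : ℝ) ^ d * Real.exp (-((101 * d + 6) * p)) := by
    intro q hq
    obtain ⟨-, hq2⟩ := Finset.mem_product.1 hq
    obtain ⟨hq3, hq4⟩ := Finset.mem_Icc.1 hq2
    have hq3' : (1 : ℝ) ≤ q.2 := by exact_mod_cast hq3
    have hηq : η ≤ η * q.2 := by nlinarith
    have hηq1 : η * q.2 ≤ 1 := by
      have h1 : (q.2 : ℝ) ≤ m := by exact_mod_cast hq4
      have h2 : (m : ℝ) ≤ 1 / η := Nat.floor_le (by positivity)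
      have h3 := h1.trans h2
      rwa [le_div_iff₀ hη, mul_comm] at h3
    have hL6 : 6 ≤ L * (η * q.2) := by
      refine (six_le_mul_sq hlam hl hL).trans ?_
      gcongr
    refine (measureReal_norm_sandwich_ge_le hd _ (hη.trans_le hηq) hηq1 hL6 hT0 hp0).trans ?_
    have hb := sinAvgBound_div_six_le hlam hηq hηq1 hl
    have hb0 : 0 ≤ sinAvgBound (η * q.2 / 6) := by
      rw [sinAvgBound]
      have : 0 < η * q.2 := hη.trans_le hηq
      have : 0 ≤ Real.log ((1 + η * q.2 / 6) / (η * q.2 / 6)) :=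
        Real.log_nonneg ((one_le_div₀ (by positivity)).2 (by linarith))
      have := Real.pi_pos
      positivity
    have hT2 : T ^ 2 = 14400 * Real.exp (101 * d + 6) * K ^ 2 * l ^ 3 := by
      have e : Real.exp ((101 * (d : ℝ) + 6) / 2) ^ 2 = Real.exp (101 * d + 6) := by
        rw [← Real.exp_nat_mul]; congr 1; push_cast; ring
      have e2 : Real.sqrt l ^ 2 = l := Real.sq_sqrt (by linarith)
      rw [hT, tailConst]
      simp only [mul_pow, e, e2]
      ring
    have hbase : 16 * p * sinAvgBound (η * q.2 / 6) ^ 2 / T ^ 2 ≤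
        Real.exp (-(101 * d + 6)) := by
      rw [div_le_iff₀ (by positivity), hT2]
      have hexp : Real.exp (-(101 * (d : ℝ) + 6)) * Real.exp (101 * d + 6) = 1 := by
        rw [← Real.exp_add]; simp
      calc 16 * p * sinAvgBound (η * q.2 / 6) ^ 2 ≤ 16 * (2 * (K ^ 2 * l)) * (20 * l) ^ 2 := by
            gcongr
        _ = 12800 * (K ^ 2 * l ^ 3) := by ring
        _ ≤ 14400 * (K ^ 2 * l ^ 3) := by gcongr; norm_num
        _ = (Real.exp (-(101 * (d : ℝ) + 6)) * Real.exp (101 * d + 6)) *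
              (14400 * (K ^ 2 * l ^ 3)) := by rw [hexp, one_mul]
        _ = _ := by ring
    have hpow : Real.exp (-((101 * d + 6) * p)) = Real.exp (-(101 * (d : ℝ) + 6)) ^ p := by
      rw [← Real.exp_nat_mul]; congr 1; ring
    rw [hpow]
    gcongr
  have hcard : (net.card : ℝ) ≤ Real.exp (5 * l) := by
    rw [hnet, Finset.card_product, Int.card_Icc, Nat.card_Icc]
    have hn1 : (n : ℝ) ≤ (2 * d + 2) / η := by
      have h1 := Nat.ceil_lt_add_one (a := (2 * d + 1 : ℝ) / η) (by positivity)
      have h2 : 1 ≤ 1 / η := (one_le_div₀ hη).2 hη1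
      have h3 : (2 * d + 2 : ℝ) / η = (2 * d + 1) / η + 1 / η := by rw [← add_div]; ring
      linarith
    have hm1 : (m : ℝ) ≤ 1 / η := Nat.floor_le (by positivity)
    have h2 : 1 ≤ 1 / η := (one_le_div₀ hη).2 hη1
    have e1 : ((n : ℤ) + 1 - -(n : ℤ)).toNat = 2 * n + 1 := by omega
    rw [e1, Nat.add_sub_cancel]
    push_cast
    have hexpl : Real.exp l = lam⁻¹ := Real.exp_log (by positivity)
    have e2 : Real.exp (5 * l) = lam⁻¹ * (1 / η) * (1 / η) := by
      rw [mul_comm, Real.exp_mul, hexpl, hηdef]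
      have := Real.rpow_natCast lam⁻¹ 5
      push_cast at this
      rw [this]
      field_simp
    rw [e2]
    gcongr
    calc 2 * (n : ℝ) + 1 ≤ 2 * ((2 * d + 2) / η) + 1 / η := by gcongr
      _ = (4 * d + 5) * (1 / η) := by field_simp; ring
      _ ≤ lam⁻¹ * (1 / η) := by gcongr
  have hsum : (potentialLaw d L).real (⋃ q ∈ net, bad q) ≤ Real.exp (-(K ^ 2 * l)) := by
    have hLd : (L : ℝ) ^ d ≤ Real.exp (101 * d * l) := by
      calc (L : ℝ) ^ d ≤ Real.exp (101 * l) ^ d := by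
            gcongr
            exact cast_le_exp hlam hl hL
        _ = Real.exp (101 * d * l) := by rw [← Real.exp_nat_mul]; congr 1; ring
    calc (potentialLaw d L).real (⋃ q ∈ net, bad q)
        ≤ ∑ q ∈ net, (potentialLaw d L).real (bad q) := measureReal_biUnion_finset_le _ _
      _ ≤ ∑ _q ∈ net, (L : ℝ) ^ d * Real.exp (-((101 * d + 6) * p)) := Finset.sum_le_sum hone
      _ = net.card * ((L : ℝ) ^ d * Real.exp (-((101 * d + 6) * p))) := by
          rw [Finset.sum_const, nsmul_eq_mul]
      _ ≤ Real.exp (5 * l) * (Real.exp (101 * d * l) * Real.exp (-((101 * d + 6) * p))) := by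
          gcongr
      _ = Real.exp (5 * l + (101 * d * l + -((101 * d + 6) * p))) := by
          rw [Real.exp_add, Real.exp_add]
      _ ≤ Real.exp (-(K ^ 2 * l)) := by
          refine Real.exp_le_exp.2 ?_
          have hd0 : (0 : ℝ) ≤ d := Nat.cast_nonneg d
          have hlp : l ≤ p := le_trans (by nlinarith [one_le_pow₀ (n := 2) hK]) hp1
          have h1 : (101 * (d : ℝ) + 5) * l ≤ (101 * d + 5) * p := by gcongr
          linarith
  have htot : 1 ≤ (potentialLaw d L).real good + (potentialLaw d L).real (⋃ q ∈ net, bad q) := by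
    have : IsProbabilityMeasure (potentialLaw d L) := by unfold potentialLaw; infer_instance
    calc (1 : ℝ) = (potentialLaw d L).real Set.univ := by simp
      _ ≤ (potentialLaw d L).real (good ∪ ⋃ q ∈ net, bad q) := measureReal_mono hcover
      _ ≤ _ := measureReal_union_le _ _
  linarith

/-- A small potential changes the Lorentzians by little; this is used when the coupling is bounded
below, where the tail bound does not beat the constants depending on `χ`. -/
theorem norm_hamiltonian_sub_laplacian_le_of_small {lam ε : ℝ} (hlam : 0 < lam) (hε : 0 ≤ ε)
    {V : Torus d L → ℝ} (hV : ∀ x, |V x| ≤ ε) (u : ℝ) {s : ℝ} (hs : 0 < s) :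
    ‖applyFun (hamiltonian_isHermitian d L lam V) (fun x => (lorentz u s x : ℂ)) -
        applyFun (laplacian_isHermitian d L) (fun x => (lorentz u s x : ℂ))‖ ≤
      4 * Real.sqrt (lam * ε) * s ^ (-(1 / 2) : ℝ) := by
  set D := ‖applyFun (hamiltonian_isHermitian d L lam V) (fun x => (lorentz u s x : ℂ)) -
        applyFun (laplacian_isHermitian d L) (fun x => (lorentz u s x : ℂ))‖ with hD
  have hD0 : 0 ≤ D := norm_nonneg _
  have h1 : D ≤ 8 * lam * (ε / s) :=
    (norm_hamiltonian_sub_laplacian_le hlam V u hs).trans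
      (mul_le_mul_of_nonneg_left (norm_sandwich_le hs hε hV) (by positivity))
  have h2 : D ≤ 2 := norm_hamiltonian_sub_laplacian_le_two lam V u s
  have h3 : 4 * Real.sqrt (lam * ε) * s ^ (-(1 / 2) : ℝ) = Real.sqrt (2 * (8 * lam * (ε / s))) := by
    rw [Real.rpow_neg hs.le, ← Real.sqrt_eq_rpow,
      show 2 * (8 * lam * (ε / s)) = 4 ^ 2 * ((lam * ε) / s) by ring,
      Real.sqrt_mul (by norm_num) (lam * ε / s), Real.sqrt_sq (by norm_num),
      Real.sqrt_div (by positivity) s]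
    ring
  rw [h3]
  refine Real.le_sqrt_of_sq_le ?_
  rw [pow_two]
  exact mul_le_mul h2 h1 hD0 zero_le_two

theorem measureReal_forall_abs_le (d L : ℕ) [NeZero L] (ε : ℝ) :
    (potentialLaw d L).real {V | ∀ x, |V x| ≤ ε} =
      (gaussianReal 0 1).real (Set.Icc (-ε) ε) ^ (L ^ d) := by
  have : {V : Torus d L → ℝ | ∀ x, |V x| ≤ ε} = Set.univ.pi fun _ => Set.Icc (-ε) ε := by
    ext V
    simp only [Set.mem_ofPred_eq, Set.mem_univ_pi, Set.mem_Icc, abs_le]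
  rw [this, potentialLaw, measureReal_def, Measure.pi_pi, Finset.prod_const, Finset.card_univ,
    Fintype.card_fun, ZMod.card, Fintype.card_fin, ENNReal.toReal_pow, measureReal_def]

theorem gaussianReal_Icc_pos {ε : ℝ} (hε : 0 < ε) :
    0 < (gaussianReal 0 1).real (Set.Icc (-ε) ε) := by
  rw [measureReal_def]
  refine ENNReal.toReal_pos (fun h => ?_) (measure_ne_top _ _)
  have h0 := (gaussianReal_absolutelyContinuous' 0 (one_ne_zero (α := NNReal))) h
  rw [Real.volume_Icc, ENNReal.ofReal_eq_zero] at h0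
  linarith

end Sandwich

end Anderson

theorem mainTheorem6 (d : ℕ) (hd : 2 ≤ d) :
    ∃ lam₀ : ℝ, 0 < lam₀ ∧ lam₀ < 1 ∧
      ∀ χ : ℝ → ℂ, ContDiff ℝ ∞ χ → HasCompactSupport χ →
        ∃ c : ℝ, 0 < c ∧
          ∀ (lam : ℝ), 0 < lam → lam < lam₀ →
          ∀ (L : ℕ) [NeZero L], |(L : ℝ) - lam ^ (-100 : ℤ)| < 1 →
          ∀ K : ℝ, 1 ≤ K →
            1 - Real.exp (-c * K ^ 2) ≤
              (Anderson.potentialLaw d L).real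
                {V : Anderson.Torus d L → ℝ | ∀ E δ : ℝ, 0 < δ →
                  Anderson.opNorm
                    (Anderson.applyFun (Anderson.hamiltonian_isHermitian d L lam V)
                        (Anderson.rescale χ δ E)
                      - Anderson.applyFun (Anderson.laplacian_isHermitian d L)
                        (Anderson.rescale χ δ E))
                    ≤ K * Real.log lam⁻¹ ^ 2 * lam * δ ^ (-(1 / 2 : ℝ))} := by
  refine ⟨(4 * d + 5 : ℝ)⁻¹, by positivity, ?_, fun χ hχ hs => ?_⟩
  · exact inv_lt_one_of_one_lt₀ (by have : (0 : ℝ) ≤ d := Nat.cast_nonneg d; linarith)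
  have hχ2 : ContDiff ℝ 2 χ := contDiff_infty.1 hχ 2
  have hC0 := Anderson.transferConst_nonneg χ
  have htc := Anderson.one_le_tailConst d
  have hd0 : (0 : ℝ) ≤ d := Nat.cast_nonneg d
  -- `B` absorbs every constant that depends on `χ`; one spare factor `√log` will beat it
  set B := max 1 (64 * (d + 1) * Anderson.tailConst d * Anderson.transferConst χ) with hB
  have hB1 : 1 ≤ B := le_max_left _ _
  have hB2 : 64 * (d + 1) * Anderson.tailConst d * Anderson.transferConst χ ≤ B := le_max_right _ _
  have hB3 : Anderson.transferConst χ ≤ B := by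
    refine le_trans ?_ hB2
    refine le_mul_of_one_le_left hC0 (one_le_mul_of_one_le_of_one_le ?_ htc)
    linarith
  -- parameters for couplings bounded below, where only finitely many `L` occur
  set ε := Real.exp (-B ^ 2) / (16 * B ^ 2) with hε
  have hε0 : 0 < ε := by positivity
  set q := (gaussianReal 0 1).real (Set.Icc (-ε) ε) with hq
  have hq0 : 0 < q := Anderson.gaussianReal_Icc_pos hε0
  have hq1 : q ≤ 1 := measureReal_le_one
  set M := ⌈Real.exp (101 * B ^ 2)⌉₊ with hM
  set Q := q ^ (M ^ d) with hQ
  have hQ0 : 0 < Q := pow_pos hq0 _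
  have hQ1 : Q ≤ 1 := pow_le_one₀ hq0.le hq1
  refine ⟨Q / B ^ 2, by positivity, fun lam hlam hlam0 L _ hL K hK => ?_⟩
  have hld : (4 * d + 5 : ℝ) ≤ lam⁻¹ := (le_inv_comm₀ (by positivity) hlam).2 hlam0.le
  have hl : 1 ≤ Real.log lam⁻¹ := by
    rw [Real.le_log_iff_exp_le (by positivity)]
    have := Real.exp_one_lt_d9
    linarith
  set l := Real.log lam⁻¹ with hldef
  have hsl : 1 ≤ Real.sqrt l := Real.one_le_sqrt.2 hl
  have hss : Real.sqrt l * Real.sqrt l = l := Real.mul_self_sqrt (by linarith)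
  have hprob : IsProbabilityMeasure (Anderson.potentialLaw d L) := by
    unfold Anderson.potentialLaw; infer_instance
  by_cases hcase : B ≤ K * Real.sqrt l
  · set K' := K * Real.sqrt l / B with hK'
    have hK'1 : 1 ≤ K' := (one_le_div₀ (by linarith)).2 hcase
    have hmain := Anderson.measureReal_lorentz_bound_ge hd hlam hl hld hL hK'1
    rw [← hldef] at hmain
    calc 1 - Real.exp (-(Q / B ^ 2) * K ^ 2) ≤ 1 - Real.exp (-(K' ^ 2 * l)) := by
          refine sub_le_sub_left (Real.exp_le_exp.2 ?_) 1
          have e : K' ^ 2 * l = 1 / B ^ 2 * K ^ 2 * (l * l) := by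
            rw [hK', div_pow, mul_pow, pow_two (Real.sqrt l), hss]; ring
          have h1 : 1 ≤ l * l := one_le_mul_of_one_le_of_one_le hl hl
          have h2 : Q / B ^ 2 * K ^ 2 ≤ 1 / B ^ 2 * K ^ 2 * (l * l) := by
            calc Q / B ^ 2 * K ^ 2 ≤ 1 / B ^ 2 * K ^ 2 := by gcongr
              _ ≤ 1 / B ^ 2 * K ^ 2 * (l * l) := le_mul_of_one_le_right (by positivity) h1
          rw [e]
          linarith
      _ ≤ _ := hmain
      _ ≤ _ := by
          refine measureReal_mono fun V hV E δ hδ => ?_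
          have h := Anderson.norm_rescale_sub_le_of_lorentz hχ2 hs _ _ hV E hδ
          refine h.trans ?_
          have hδ' : 0 ≤ δ ^ (-(1 / 2 : ℝ)) := Real.rpow_nonneg hδ.le _
          refine mul_le_mul_of_nonneg_right ?_ hδ'
          calc Anderson.transferConst χ *
                (64 * (d + 1) * (Anderson.tailConst d * K' * (l * Real.sqrt l)) * lam)
              = (64 * (d + 1) * Anderson.tailConst d * Anderson.transferConst χ) *
                (K' * (l * Real.sqrt l) * lam) := by ring
            _ ≤ B * (K' * (l * Real.sqrt l) * lam) := by gcongr
            _ = K * (Real.sqrt l * Real.sqrt l) * l * lam := by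
                rw [hK']
                field_simp
            _ = K * l ^ 2 * lam := by rw [hss]; ring
  · push Not at hcase
    have hKB : K < B := (le_mul_of_one_le_right (by linarith) hsl).trans_lt hcase
    have hlB : l ≤ B ^ 2 := by
      have h1 : Real.sqrt l ≤ B := (le_mul_of_one_le_left (by linarith) hK).trans hcase.le
      calc l = Real.sqrt l * Real.sqrt l := hss.symm
        _ ≤ B * B := by gcongr
        _ = B ^ 2 := by ring
    have hlamB : Real.exp (-B ^ 2) ≤ lam := by
      have : lam = Real.exp (-l) := by
        rw [hldef, Real.log_inv, neg_neg, Real.exp_log hlam]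
      rw [this]
      exact Real.exp_le_exp.2 (by linarith)
    have hLM : L ≤ M := by
      have h1 : (L : ℝ) ≤ M := by
        refine (Anderson.cast_le_exp hlam hl hL).trans (le_trans ?_ (Nat.le_ceil _))
        exact Real.exp_le_exp.2 (by linarith)
      exact_mod_cast h1
    calc 1 - Real.exp (-(Q / B ^ 2) * K ^ 2) ≤ Q / B ^ 2 * K ^ 2 := by
          have := Real.add_one_le_exp (-(Q / B ^ 2) * K ^ 2)
          linarith
      _ ≤ Q / B ^ 2 * B ^ 2 := by gcongr
      _ = Q := div_mul_cancel₀ _ (by positivity)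
      _ ≤ q ^ (L ^ d) := pow_le_pow_of_le_one hq0.le hq1 (Nat.pow_le_pow_left hLM d)
      _ = _ := (Anderson.measureReal_forall_abs_le d L ε).symm
      _ ≤ _ := by
          refine measureReal_mono fun V hV E δ hδ => ?_
          have h := Anderson.norm_rescale_sub_le_of_lorentz hχ2 hs
            (Anderson.laplacian_isHermitian d L) (Anderson.hamiltonian_isHermitian d L lam V)
            (fun u s hs => Anderson.norm_hamiltonian_sub_laplacian_le_of_small hlam hε0.le hV u hs)
            E hδ
          refine h.trans ?_
          have hδ' : 0 ≤ δ ^ (-(1 / 2 : ℝ)) := Real.rpow_nonneg hδ.le _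
          refine mul_le_mul_of_nonneg_right ?_ hδ'
          have hsq : Real.sqrt (lam * ε) ≤ lam / (4 * B) := by
            refine Real.sqrt_le_iff.2 ⟨by positivity, ?_⟩
            calc lam * ε ≤ lam * (lam / (16 * B ^ 2)) := by rw [hε]; gcongr
              _ = (lam / (4 * B)) ^ 2 := by field_simp; ring
          calc Anderson.transferConst χ * (4 * Real.sqrt (lam * ε))
              ≤ B * (4 * (lam / (4 * B))) := by gcongr
            _ = 1 * lam := by field_simp
            _ ≤ K * l ^ 2 * lam := by
                gcongr
                exact one_le_mul_of_one_le_of_one_le hK (one_le_pow₀ hl)
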